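/- Let $X$ be a finite set with $n$ elements and let $r : X\times X\to X\times X$ be a bijection, written $r(x,y)=({}^xy,x^y)$. Assume that $(X,r)$ is non-degenerate (for each $x\in X$ the maps $y\mapsto {}^xy$ and $y\mapsto y^x$ are bijections of $X$) and involutive ($r^2=\mathrm{id}$). Let $\mathbf k$ be a field, let $I$ be the two-sided ideal of the free associative algebra $\mathbf k\langle X\rangle$ generated by all $xy-y'x'$ with $r(x,y)=(y',x')\neq(x,y)$, and let $\mathcal A=\mathcal A(\mathbf k,X,r)=\mathbf k\langle X\rangle/I$. Let $X=\{x_1,\dots,x_n\}$ be an enumeration and order the words in $X$ degree-lexicographically with $x_1<\dots<x_n$; $\mathbf{LM}(f)$ denotes the leading monomial of $f\ne0$. Let $\Re_0$ be the set of the monic relations, i.e. of all $xy-y'x'$ with $r(x,y)=(y',x')$ and $y'x'<xy$. Assume that the set of words which are normal modulo $I$ (contain no $\mathbf{LM}(f)$, $0\neq f\in I$, as a subword) is exactly $$\{x_1^{\alpha_1}x_2^{\alpha_2}\cdots x_n^{\alpha_n}\mid \alpha_i\ge 0,\ 1\le i\le n\},$$ so that these ordered monomials form the normal $\mathbf k$-basis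 of $\mathcal A$. Then: I. $\mathcal A$ is a PBW algebra with PBW generators $x_1,\dots,x_n$ (that is, $I$ has a finite set of generators, homogeneous of degree two, which is a Gröbner basis of $I$ for the above order), and $\Re_0$ is itself a quadratic Gröbner basis of $I$. II. The following are equivalent: (1) $\mathcal A$ is left and right Noetherian. (2) $(X,r)$ is square-free: $r(x,x)=(x,x)$ for all $x\in X$. (3) $(X,r)$ is a solution of the Yang–Baxter equation: $r^{12}r^{23}r^{12}=r^{23}r^{12}r^{23}$ on $X\times X\times X$, where $r^{12}=r\times\mathrm{id}_X$ and $r^{23}=\mathrm{id}_X\times r$. (4) $\mathcal A$ is a binomial skew polynomial ring with respect to the enumeration $x_1,\dots,x_n$. (4') $\mathcal A$ is a binomial skew polynomial ring with respect to some enumeration of $X$. Here $\mathcal A=\mathbf k\langle X\rangle/I$ is a binomial skew polynomial ring with respect to an enumeration $y_1,\dots,y_n$ of $X$ if $I$ is generated by a set of polynomials $f_{ji}=y_jy_i-c_{ij}\,y_{i'}y_{j'}$, one for each pair $1\le i<j\le n$ (with $i',j'$ depending on $i,j$), such that (a) $c_{ij}\in\mathbf k^\times$; (b) $j>i'$ and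 $i'<j'$ for every pair $i<j$; (c) every $y_iy_j$ with $i<j$ occurs as a second term in some $f_{qp}$; (d) the set of all $f_{ji}$ is the reduced Gröbner basis of $I$ for the degree-lexicographic order with $y_1<\dots<y_n$. -/

import Mathlib

/-! ### Quadratic sets -/

namespace QuadraticSet

variable {X : Type*}

/-- The left action `ℒ_x(y) = ˣy`, where `r(x, y) = (ˣy, xʸ)`. -/
def leftAct (r : X × X ≃ X × X) (x y : X) : X := (r (x, y)).1

/-- The right action `ℛ_y(x) = xʸ`, where `r(x, y) = (ˣy, xʸ)`. -/
def rightAct (r : X × X ≃ X × X) (y x : X) : X := (r (x, y)).2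

/-- All the maps `ℒ_x` and `ℛ_x` are bijective. -/
def IsNondegenerate (r : X × X ≃ X × X) : Prop :=
  (∀ x, Function.Bijective (leftAct r x)) ∧ ∀ x, Function.Bijective (rightAct r x)

/-- `r² = id`. -/
def IsInvolutive (r : X × X ≃ X × X) : Prop := ∀ p, r (r p) = p

/-- `r(x, x) = (x, x)` for all `x`. -/
def IsSquareFree (r : X × X ≃ X × X) : Prop := ∀ x, r (x, x) = (x, x)

/-- `r¹² = r × id`. -/
def r12 (r : X × X ≃ X × X) (t : X × X × X) : X × X × X :=
  ((r (t.1, t.2.1)).1, (r (t.1, t.2.1)).2, t.2.2)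

/-- `r²³ = id × r`. -/
def r23 (r : X × X ≃ X × X) (t : X × X × X) : X × X × X := (t.1, r t.2)

/-- The braid relation `r¹² r²³ r¹² = r²³ r¹² r²³` on `X × X × X`. -/
def SatisfiesYBE (r : X × X ≃ X × X) : Prop :=
  r12 r ∘ r23 r ∘ r12 r = r23 r ∘ r12 r ∘ r23 r

end QuadraticSet

/-! ### Gröbner bases in the free associative algebra -/

namespace FreeGroebner

variable {k X : Type*} [Field k] {n : ℕ}

/-- The coefficient of the word `u` in the noncommutative polynomial `f`. -/
noncomputable def coeff (f : FreeAlgebra k X) (u : FreeMonoid X) : k :=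
  (FreeAlgebra.basisFreeMonoid k X).repr f u

/-- The degree-lexicographic order on words for the enumeration `x 0 < x 1 < ⋯` of `X`. -/
def DegLex (x : Fin n ≃ X) (u v : FreeMonoid X) : Prop :=
  u.length < v.length ∨
    (u.length = v.length ∧
      List.Lex (fun a b => x.symm a < x.symm b) u.toList v.toList)

/-- `u` is the leading monomial of `f`. (The zero polynomial has none.) -/
def IsLM (x : Fin n ≃ X) (f : FreeAlgebra k X) (u : FreeMonoid X) : Prop :=
  coeff f u ≠ 0 ∧ ∀ v, coeff f v ≠ 0 → v ≠ u → DegLex x v u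

/-- `w` occurs in `u` as a (contiguous) subword. -/
def IsSubword (w u : FreeMonoid X) : Prop := ∃ a b, u = a * w * b

/-- The words that contain no leading monomial of an element of `F` as a subword. -/
def normalWords (x : Fin n ≃ X) (F : Set (FreeAlgebra k X)) : Set (FreeMonoid X) :=
  {u | ∀ f ∈ F, ∀ w, IsLM x f w → ¬ IsSubword w u}

/-- The ordered monomials `x₁^α₁ x₂^α₂ ⋯ xₙ^αₙ`. -/
def orderedMonomials (x : Fin n ≃ X) : Set (FreeMonoid X) :=
  {u | ∃ α : Fin n → ℕ, u = (List.ofFn fun i => FreeMonoid.of (x i) ^ α i).prod}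

/-- `G` is a Gröbner basis (consisting of monic polynomials) of the two-sided ideal `I`. -/
def IsGroebnerBasis (x : Fin n ≃ X) (G : Set (FreeAlgebra k X))
    (I : TwoSidedIdeal (FreeAlgebra k X)) : Prop :=
  (∀ g ∈ G, ∃ u, IsLM x g u ∧ coeff g u = 1) ∧
    TwoSidedIdeal.span G = I ∧
      ∀ f ∈ I, ∀ u, IsLM x f u → ∃ g ∈ G, ∃ w, IsLM x g w ∧ IsSubword w u

/-- `G` is a reduced Gröbner basis of the two-sided ideal `I`. -/
def IsReducedGroebnerBasis (x : Fin n ≃ X) (G : Set (FreeAlgebra k X))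
    (I : TwoSidedIdeal (FreeAlgebra k X)) : Prop :=
  IsGroebnerBasis x G I ∧
    (∀ f ∈ G, ¬ IsGroebnerBasis x (G \ {f}) I) ∧
      ∀ f ∈ G, ∀ u, coeff f u ≠ 0 → u ∈ normalWords x (G \ {f})

/-- Homogeneous polynomials of degree two. -/
def IsQuadratic (f : FreeAlgebra k X) : Prop := ∀ u, coeff f u ≠ 0 → u.length = 2

/-- The algebra `k⟨X⟩ / I` is PBW with PBW generators `x₁, …, xₙ` (in this order): the ideal `I`
has a finite set of quadratic generators which is a Gröbner basis. -/
def IsPBW (x : Fin n ≃ X) (I : TwoSidedIdeal (FreeAlgebra k X)) : Prop :=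
  ∃ F : Set (FreeAlgebra k X), F.Finite ∧ (∀ f ∈ F, IsQuadratic f) ∧ IsGroebnerBasis x F I

/-- The polynomials `x_j x_i - c_{ij} x_{i'} x_{j'}` for `i < j`, where `(i', j') = s i j`. -/
noncomputable def binomialRelations (x : Fin n ≃ X) (c : Fin n → Fin n → k)
    (s : Fin n → Fin n → Fin n × Fin n) : Set (FreeAlgebra k X) :=
  {f | ∃ i j : Fin n, i < j ∧
    f = FreeAlgebra.ι k (x j) * FreeAlgebra.ι k (x i) -
      c i j • (FreeAlgebra.ι k (x (s i j).1) * FreeAlgebra.ι k (x (s i j).2))}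

/-- The algebra `k⟨x₁, …, xₙ⟩ / I` is a binomial skew polynomial ring with respect to the
enumeration `x₁, …, xₙ` of its generators. -/
def IsBinomialSkewPolynomialRing (x : Fin n ≃ X) (I : TwoSidedIdeal (FreeAlgebra k X)) : Prop :=
  ∃ (c : Fin n → Fin n → k) (s : Fin n → Fin n → Fin n × Fin n),
    (∀ i j, i < j → c i j ≠ 0) ∧
    (∀ i j, i < j → (s i j).1 < j ∧ (s i j).1 < (s i j).2) ∧
    (∀ i j, i < j → ∃ p q, p < q ∧ s p q = (i, j)) ∧
    IsReducedGroebnerBasis x (binomialRelations x c s) I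

end FreeGroebner

/-! ### The quadratic algebra of a quadratic set -/

namespace QuadraticSet

variable (k : Type*) [Field k] {X : Type*} {n : ℕ}

/-- The polynomials `xy - y'x'` with `r(x, y) = (y', x') ≠ (x, y)`. -/
def relations (r : X × X ≃ X × X) : Set (FreeAlgebra k X) :=
  {f | ∃ x y y' x' : X, r (x, y) = (y', x') ∧ (x, y) ≠ (y', x') ∧
    f = FreeAlgebra.ι k x * FreeAlgebra.ι k y - FreeAlgebra.ι k y' * FreeAlgebra.ι k x'}

/-- The two-sided ideal of `k⟨X⟩` generated by the relations of `(X, r)`. -/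
def relationIdeal (r : X × X ≃ X × X) : TwoSidedIdeal (FreeAlgebra k X) :=
  TwoSidedIdeal.span (relations k r)

/-- The quadratic algebra `A(k, X, r)`. -/
abbrev quadraticAlgebra (r : X × X ≃ X × X) : Type _ := (relationIdeal k r).ringCon.Quotient

/-- The relations `xy - y'x'` of `(X, r)` written with the larger word first. For an involutive `r`,
each relation occurs in `relations k r` together with its negative; this is the one of the two
that is monic. -/
def monicRelations (r : X × X ≃ X × X) (e : Fin n ≃ X) : Set (FreeAlgebra k X) :=
  {f | ∃ x y y' x' : X, r (x, y) = (y', x') ∧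
    FreeGroebner.DegLex e (FreeMonoid.of y' * FreeMonoid.of x')
      (FreeMonoid.of x * FreeMonoid.of y) ∧
    f = FreeAlgebra.ι k x * FreeAlgebra.ι k y - FreeAlgebra.ι k y' * FreeAlgebra.ι k x'}

end QuadraticSet

/-! ### The degree-lexicographic order -/

namespace FreeGroebner

section DegLex

variable {X : Type*} {n : ℕ} (x : Fin n ≃ X)

/-! The relations are differences of words, so everything reduces to the monoid congruence `wordCon`
generated by `xy ∼ r(x, y)`: a word is normal modulo the ideal exactly when it is the least word of
its class (`mem_normalWords_iff`). The hypothesis thus says that every class contains exactly one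
sorted word, its minimum. Each descent `x_j x_i`, `i < j`, is then lowered by `r`, and since an
unsorted word contains an adjacent descent, the monic relations form a Gröbner basis.

All five conditions of part II hold outright. Square-freeness comes from following the fixed points
of `r` (`isSquareFree`), and the binomial form of the relations follows from it and the action of
`r` on descents.

The Yang–Baxter equation is a counting argument (`satisfiesYBE`). The involutions `r12` and `r23`
preserve each class of three-letter words, and commute only at diagonal triples. Give a class `O`
the weight `2|O| + 3(|Fix r12| + |Fix r23|)`. It is at least 12 for a non-diagonal class
(`weight_of_stable`) and at least 8 for a diagonal one. There are `n(n+1)(n+2)/6` classes, one per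
sorted triple, and `n` of them are diagonal, so these bounds add up to `2n³ + 6n²`, which is the
total weight. Every bound is therefore attained, and this forces the braid relation.

For the Noetherian property, the cyclic condition makes sufficiently divisible powers of the
generators commute with each other and pass through generators up to a permutation. The algebra is
then finite, on either side, over a finitely generated commutative subalgebra. -/

theorem degLex_iff_shortlex {u v : FreeMonoid X} :
    DegLex x u v ↔ List.Shortlex (fun a b => x.symm a < x.symm b) u.toList v.toList :=
  List.shortlex_def.symm

theorem degLex_wellFounded : WellFounded (DegLex x) := by
  have h : WellFounded fun a b : X => x.symm a < x.symm b := InvImage.wf x.symm wellFounded_lt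
  exact Subrelation.wf (fun {u v} huv => (degLex_iff_shortlex x).1 huv)
    (InvImage.wf FreeMonoid.toList (List.Shortlex.wf h))

theorem degLex_irrefl (u : FreeMonoid X) : ¬ DegLex x u u := fun h =>
  (degLex_wellFounded x).asymmetric _ _ h h

theorem degLex_asymm {u v : FreeMonoid X} (h : DegLex x u v) : ¬ DegLex x v u :=
  (degLex_wellFounded x).asymmetric _ _ h

theorem degLex_trichotomy (u v : FreeMonoid X) : DegLex x u v ∨ u = v ∨ DegLex x v u := by
  have : Std.Trichotomous fun a b : X => x.symm a < x.symm b :=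
    ⟨fun a b h1 h2 => x.symm.injective (le_antisymm (not_lt.1 h2) (not_lt.1 h1))⟩
  by_cases h1 : DegLex x u v
  · exact Or.inl h1
  by_cases h2 : DegLex x v u
  · exact Or.inr (Or.inr h2)
  rw [degLex_iff_shortlex] at h1 h2
  exact Or.inr (Or.inl (FreeMonoid.toList.injective
    (Std.Trichotomous.trichotomous (r := List.Shortlex _) _ _ h1 h2)))

/-- Equal lengths exclude the `nil` case: if `s` is a proper prefix of `t`, appending letters can
reverse the order. -/
theorem lex_append_of_length_eq {α : Type*} {r : α → α → Prop} {s t : List α}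
    (h : List.Lex r s t) (hl : s.length = t.length) (l : List α) :
    List.Lex r (s ++ l) (t ++ l) := by
  induction h with
  | nil => simp at hl
  | rel h => exact .rel h
  | cons _ ih => exact .cons (ih (by simpa using hl))

theorem DegLex.mul {u v : FreeMonoid X} (h : DegLex x u v) (a b : FreeMonoid X) :
    DegLex x (a * u * b) (a * v * b) := by
  rcases h with h | ⟨h, h'⟩
  · left
    simp only [FreeMonoid.length_mul]
    omega
  · right
    refine ⟨by simp only [FreeMonoid.length_mul, h], ?_⟩
    simp only [FreeMonoid.toList_mul]
    exact lex_append_of_length_eq (List.Lex.append_left _ h' _)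
      (by simpa [FreeMonoid.length] using h) _

theorem degLex_pair {a b c d : X} :
    DegLex x (FreeMonoid.of a * FreeMonoid.of b) (FreeMonoid.of c * FreeMonoid.of d) ↔
      x.symm a < x.symm c ∨ a = c ∧ x.symm b < x.symm d := by
  simp only [DegLex, FreeMonoid.length_mul, FreeMonoid.length_of, lt_irrefl, false_or, true_and,
    FreeMonoid.toList_mul, FreeMonoid.toList_of, List.singleton_append]
  constructor
  · rintro (_ | h | h)
    · exact Or.inl h
    · exact Or.inr ⟨rfl, (List.lex_singleton_iff (r := fun a b => x.symm a < x.symm b) _ _).1 h⟩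
  · rintro (h | ⟨rfl, h⟩)
    · exact .rel h
    · exact .cons (.rel h)

end DegLex

/-! ### Words as a basis of the free algebra -/

section Words

variable (k : Type*) {X : Type*} [Field k]

theorem basisFreeMonoid_eq_lift (u : FreeMonoid X) :
    FreeAlgebra.basisFreeMonoid k X u = FreeMonoid.lift (FreeAlgebra.ι k) u := by
  simp [FreeAlgebra.basisFreeMonoid, FreeAlgebra.equivMonoidAlgebraFreeMonoid]

/-- A word, as an element of the free algebra. -/
noncomputable def wordHom : FreeMonoid X →* FreeAlgebra k X := FreeMonoid.lift (FreeAlgebra.ι k)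

theorem wordHom_of (a : X) : wordHom k (FreeMonoid.of a) = FreeAlgebra.ι k a := by
  simp [wordHom]

theorem wordHom_pair (a b : X) :
    wordHom k (FreeMonoid.of a * FreeMonoid.of b) = FreeAlgebra.ι k a * FreeAlgebra.ι k b := by
  simp [wordHom]

open Classical in
theorem coeff_wordHom (u v : FreeMonoid X) :
    coeff (wordHom k u) v = if v = u then 1 else 0 := by
  rw [coeff, wordHom, ← basisFreeMonoid_eq_lift, Module.Basis.repr_self, Finsupp.single_apply]
  simp only [eq_comm]

theorem coeff_sub (f g : FreeAlgebra k X) (v : FreeMonoid X) :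
    coeff (f - g) v = coeff f v - coeff g v := by
  simp [coeff]

theorem eq_sum_coeff (f : FreeAlgebra k X) :
    f = ((FreeAlgebra.basisFreeMonoid k X).repr f).sum fun u c => c • wordHom k u := by
  conv_lhs => rw [← (FreeAlgebra.basisFreeMonoid k X).linearCombination_repr f]
  rw [Finsupp.linearCombination_apply]
  simp only [basisFreeMonoid_eq_lift, wordHom]

variable {k} {n : ℕ} {x : Fin n ≃ X}

theorem IsLM.unique {f : FreeAlgebra k X} {u v : FreeMonoid X} (hu : IsLM x f u)
    (hv : IsLM x f v) : u = v := by
  by_contra h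
  exact degLex_asymm x (hu.2 v hv.1 (Ne.symm h)) (hv.2 u hu.1 h)

theorem coeff_wordHom_sub_ne_zero {u v w : FreeMonoid X}
    (h : coeff (wordHom k u - wordHom k v) w ≠ 0) : w = u ∨ w = v := by
  classical
  rw [coeff_sub, coeff_wordHom, coeff_wordHom] at h
  by_contra! h'
  simp [h'.1, h'.2] at h

theorem coeff_wordHom_sub_self {u v : FreeMonoid X} (h : u ≠ v) :
    coeff (wordHom k u - wordHom k v) u = 1 := by
  classical
  rw [coeff_sub, coeff_wordHom, coeff_wordHom]
  simp [h]

theorem isLM_wordHom_sub {u v : FreeMonoid X} (h : DegLex x v u) :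
    IsLM x (wordHom k u - wordHom k v) u := by
  have hne : u ≠ v := by
    rintro rfl
    exact degLex_irrefl x _ h
  refine ⟨by simp [coeff_wordHom_sub_self hne], fun w hw hwu => ?_⟩
  rcases coeff_wordHom_sub_ne_zero hw with rfl | rfl
  · exact absurd rfl hwu
  · exact h

theorem isSubword_refl (u : FreeMonoid X) : IsSubword u u := ⟨1, 1, by simp⟩

theorem IsSubword.eq_of_length_eq {u v : FreeMonoid X} (h : IsSubword u v)
    (hl : u.length = v.length) : u = v := by
  obtain ⟨a, b, rfl⟩ := h
  simp only [FreeMonoid.length_mul] at hl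
  have ha : a = 1 := FreeMonoid.length_eq_zero.1 (by omega)
  have hb : b = 1 := FreeMonoid.length_eq_zero.1 (by omega)
  simp [ha, hb]

end Words

/-! ### Ordered monomials -/

section Ordered

variable {X : Type*} {n : ℕ} {x : Fin n ≃ X}

theorem orderedMonomial_toList (α : Fin n → ℕ) :
    ((List.ofFn fun i => FreeMonoid.of (x i) ^ α i).prod).toList =
      ((List.finRange n).map fun i => List.replicate (α i) (x i)).flatten := by
  have key : ∀ (a : X) (m : ℕ), (FreeMonoid.of a ^ m).toList = List.replicate m a := by
    intro a m
    induction m with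
    | zero => rfl
    | succ m ih =>
      rw [pow_succ', FreeMonoid.toList_mul, ih]
      rfl
  rw [FreeMonoid.toList_prod, List.ofFn_eq_map, List.map_map]
  congr 1
  exact List.map_congr_left fun i _ => key _ _

theorem mem_orderedMonomials_iff {u : FreeMonoid X} :
    u ∈ orderedMonomials x ↔ u.toList.Pairwise fun a b => x.symm a ≤ x.symm b := by
  classical
  have hsorted : ∀ α : Fin n → ℕ,
      (((List.finRange n).map fun i => List.replicate (α i) (x i)).flatten).Pairwise
        fun a b => x.symm a ≤ x.symm b := by
    intro α
    rw [List.pairwise_flatten]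
    constructor
    · intro l hl
      obtain ⟨i, -, rfl⟩ := List.mem_map.1 hl
      exact List.pairwise_replicate.2 (Or.inr le_rfl)
    · rw [List.pairwise_map]
      refine (List.pairwise_lt_finRange n).imp ?_
      intro i j hij a ha b hb
      rw [List.eq_of_mem_replicate ha, List.eq_of_mem_replicate hb]
      simpa using hij.le
  constructor
  · rintro ⟨α, rfl⟩
    rw [orderedMonomial_toList]
    exact hsorted α
  · intro hu
    -- The exponents are the letter counts; two sorted lists with the same letters coincide.
    refine ⟨fun i => u.toList.count (x i), FreeMonoid.toList.injective ?_⟩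
    rw [orderedMonomial_toList]
    refine List.Perm.eq_of_pairwise (fun a b _ _ h1 h2 => x.symm.injective (le_antisymm h1 h2))
      hu (hsorted _) ?_
    rw [List.perm_iff_count]
    intro a
    rw [List.count_flatten, List.map_map]
    have : (List.count a ∘ fun i => List.replicate (u.toList.count (x i)) (x i)) =
        fun i => if i = x.symm a then u.toList.count a else 0 := by
      funext i
      by_cases hi : i = x.symm a
      · subst hi
        simp
      · have : x i ≠ a := fun h => hi (by simp [← h])
        simp [hi, List.count_replicate, this]
    rw [this, ← List.ofFn_eq_map, List.sum_ofFn, Finset.sum_ite_eq' Finset.univ]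
    simp

theorem pair_mem_orderedMonomials {a b : X} :
    FreeMonoid.of a * FreeMonoid.of b ∈ orderedMonomials x ↔ x.symm a ≤ x.symm b := by
  simp [mem_orderedMonomials_iff]

theorem triple_mem_orderedMonomials {a b c : X} :
    FreeMonoid.of a * FreeMonoid.of b * FreeMonoid.of c ∈ orderedMonomials x ↔
      x.symm a ≤ x.symm b ∧ x.symm b ≤ x.symm c := by
  simp only [mem_orderedMonomials_iff, FreeMonoid.toList_mul, FreeMonoid.toList_of]
  simp
  exact fun h2 h1 => h1.trans h2

/-- By transitivity of `≤`, a word that is nowhere decreasing between neighbours is sorted. This is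
why leading words of length two suffice. -/
theorem exists_descent {u : FreeMonoid X} (hu : u ∉ orderedMonomials x) :
    ∃ a b, x.symm b < x.symm a ∧ IsSubword (FreeMonoid.of a * FreeMonoid.of b) u := by
  rw [mem_orderedMonomials_iff] at hu
  have h2 : ¬ List.IsChain (fun a b => x.symm a ≤ x.symm b) u.toList := by
    intro h
    have : IsTrans X fun a b => x.symm a ≤ x.symm b := ⟨fun a b c => le_trans⟩
    exact hu h.pairwise
  rw [List.isChain_iff_forall_rel_of_append_cons_cons] at h2
  push Not at h2
  obtain ⟨a, b, l₁, l₂, h, hab⟩ := h2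
  refine ⟨a, b, hab, FreeMonoid.ofList l₁, FreeMonoid.ofList l₂,
    FreeMonoid.toList.injective ?_⟩
  simp [h]

end Ordered

end FreeGroebner

/-! ### The structure monoid of a quadratic set -/

namespace QuadraticSet

open FreeGroebner

section Rewriting

variable {X : Type*} (r : X × X ≃ X × X)

/-- `v` arises from `u` by applying `r` to two consecutive letters. -/
def RewriteStep (u v : FreeMonoid X) : Prop :=
  ∃ (a b : FreeMonoid X) (p : X × X),
    u = a * (FreeMonoid.of p.1 * FreeMonoid.of p.2) * b ∧
      v = a * (FreeMonoid.of (r p).1 * FreeMonoid.of (r p).2) * b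

variable {r}

theorem RewriteStep.mul {u v : FreeMonoid X} (h : RewriteStep r u v) (c d : FreeMonoid X) :
    RewriteStep r (c * u * d) (c * v * d) := by
  obtain ⟨a, b, p, rfl, rfl⟩ := h
  exact ⟨c * a, b * d, p, by simp only [mul_assoc], by simp only [mul_assoc]⟩

theorem eqvGen_rewriteStep_mul {u v : FreeMonoid X} (h : Relation.EqvGen (RewriteStep r) u v)
    (c d : FreeMonoid X) : Relation.EqvGen (RewriteStep r) (c * u * d) (c * v * d) := by
  induction h with
  | rel _ _ h => exact .rel _ _ (h.mul c d)
  | refl _ => exact .refl _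
  | symm _ _ _ ih => exact ih.symm
  | trans _ _ _ _ _ ih₁ ih₂ => exact ih₁.trans _ _ _ ih₂

variable (r) in
/-- The congruence on words generated by `xy ∼ r(x, y)`. -/
def wordCon : Con (FreeMonoid X) where
  r := Relation.EqvGen (RewriteStep r)
  iseqv := Relation.EqvGen.is_equivalence _
  mul' {u v w z} h₁ h₂ := by
    have e₁ := eqvGen_rewriteStep_mul h₁ 1 w
    have e₂ := eqvGen_rewriteStep_mul h₂ v 1
    simp only [one_mul, mul_one] at e₁ e₂
    exact e₁.trans _ _ _ e₂

theorem RewriteStep.wordCon {u v : FreeMonoid X} (h : RewriteStep r u v) : wordCon r u v :=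
  .rel _ _ h

theorem wordCon_pair (p : X × X) :
    wordCon r (FreeMonoid.of p.1 * FreeMonoid.of p.2)
      (FreeMonoid.of (r p).1 * FreeMonoid.of (r p).2) :=
  RewriteStep.wordCon ⟨1, 1, p, by simp, by simp⟩

theorem wordCon_length {u v : FreeMonoid X} (h : wordCon r u v) : u.length = v.length := by
  replace h : Relation.EqvGen (RewriteStep r) u v := h
  induction h with
  | rel _ _ h =>
    obtain ⟨a, b, p, rfl, rfl⟩ := h
    simp [FreeMonoid.length_mul]
  | refl _ => rfl
  | symm _ _ _ ih => exact ih.symm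
  | trans _ _ _ _ _ ih₁ ih₂ => exact ih₁.trans ih₂

theorem length_two_cases {a b c d : X} {u v : FreeMonoid X}
    (h : FreeMonoid.of a * FreeMonoid.of b = u * (FreeMonoid.of c * FreeMonoid.of d) * v) :
    u = 1 ∧ v = 1 ∧ a = c ∧ b = d := by
  have hl := congrArg FreeMonoid.length h
  simp only [FreeMonoid.length_mul, FreeMonoid.length_of] at hl
  have hu : u = 1 := FreeMonoid.length_eq_zero.1 (by omega)
  have hv : v = 1 := FreeMonoid.length_eq_zero.1 (by omega)
  subst hu hv
  have := congrArg FreeMonoid.toList h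
  simp at this
  exact ⟨rfl, rfl, this⟩

theorem pair_injective {a b c d : X}
    (h : FreeMonoid.of a * FreeMonoid.of b = FreeMonoid.of c * FreeMonoid.of d) :
    a = c ∧ b = d :=
  (length_two_cases (u := 1) (v := 1) (by simpa using h)).2.2

/-- For an involutive `r`, the class of a word of length two is an orbit of `r`. -/
theorem wordCon_pair_cases (hinv : IsInvolutive r) {p : X × X} {v : FreeMonoid X}
    (h : wordCon r (FreeMonoid.of p.1 * FreeMonoid.of p.2) v) :
    v = FreeMonoid.of p.1 * FreeMonoid.of p.2 ∨
      v = FreeMonoid.of (r p).1 * FreeMonoid.of (r p).2 := by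
  let P : FreeMonoid X → Prop := fun v => v = FreeMonoid.of p.1 * FreeMonoid.of p.2 ∨
      v = FreeMonoid.of (r p).1 * FreeMonoid.of (r p).2
  -- A two-letter word can be rewritten only as a whole, and `r` merely swaps `p` and `r p`.
  have key : ∀ u w, RewriteStep r u w → (P u ↔ P w) := by
    rintro u w ⟨a, b, q, rfl, rfl⟩
    have aux : ∀ (q s : X × X),
        a * (FreeMonoid.of q.1 * FreeMonoid.of q.2) * b = FreeMonoid.of s.1 * FreeMonoid.of s.2 →
        a * (FreeMonoid.of (r q).1 * FreeMonoid.of (r q).2) * b =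
          FreeMonoid.of (r s).1 * FreeMonoid.of (r s).2 := by
      intro q s h
      obtain ⟨rfl, rfl, h1, h2⟩ := length_two_cases h.symm
      obtain rfl : s = q := Prod.ext h1 h2
      simp
    have h1 := aux q p
    have h2 := aux q (r p)
    have h3 := aux (r q) p
    have h4 := aux (r q) (r p)
    rw [hinv] at h2 h3 h4
    rw [hinv p] at h4
    constructor
    · rintro (h | h)
      exacts [Or.inr (h1 h), Or.inl (h2 h)]
    · rintro (h | h)
      exacts [Or.inr (h3 h), Or.inl (h4 h)]
  have gen : ∀ u w, Relation.EqvGen (RewriteStep r) u w → (P u ↔ P w) := by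
    intro u w h
    induction h with
    | rel _ _ h => exact key _ _ h
    | refl _ => rfl
    | symm _ _ _ ih => exact ih.symm
    | trans _ _ _ _ _ ih₁ ih₂ => exact ih₁.trans ih₂
  exact (gen _ _ h).1 (Or.inl rfl)

end Rewriting

/-! ### Normal words modulo the relation ideal -/

section NormalWords

variable {k : Type*} [Field k] {X : Type*} {r : X × X ≃ X × X}

theorem wordHom_sub_mem {u v : FreeMonoid X} (h : wordCon r u v) :
    wordHom k u - wordHom k v ∈ relationIdeal k r := by
  replace h : Relation.EqvGen (RewriteStep r) u v := h
  induction h with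
  | rel u v h =>
    obtain ⟨a, b, p, rfl, rfl⟩ := h
    by_cases hp : p = r p
    · rw [← hp, sub_self]
      exact TwoSidedIdeal.zero_mem _
    · have hmem : FreeAlgebra.ι k p.1 * FreeAlgebra.ι k p.2 -
          FreeAlgebra.ι k (r p).1 * FreeAlgebra.ι k (r p).2 ∈ relationIdeal k r :=
        TwoSidedIdeal.subset_span ⟨p.1, p.2, (r p).1, (r p).2, rfl, hp, rfl⟩
      have := TwoSidedIdeal.mul_mem_right _ _ (wordHom k b)
        (TwoSidedIdeal.mul_mem_left _ (wordHom k a) _ hmem)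
      rw [map_mul, map_mul, wordHom_pair, map_mul, map_mul, wordHom_pair, ← sub_mul, ← mul_sub]
      exact this
  | refl _ =>
    rw [sub_self]
    exact TwoSidedIdeal.zero_mem _
  | symm _ _ _ ih =>
    rw [← neg_sub]
    exact TwoSidedIdeal.neg_mem _ ih
  | trans u v w _ _ ih₁ ih₂ =>
    rw [← sub_add_sub_cancel _ (wordHom k v)]
    exact TwoSidedIdeal.add_mem _ ih₁ ih₂

variable (k r) in
/-- The projection of the free algebra onto the monoid algebra of the structure monoid. -/
noncomputable def toMonoidAlgebra :
    FreeAlgebra k X →ₐ[k] MonoidAlgebra k (wordCon r).Quotient :=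
  FreeAlgebra.lift k fun a => MonoidAlgebra.single ((FreeMonoid.of a : FreeMonoid X) :
    (wordCon r).Quotient) 1

theorem toMonoidAlgebra_wordHom (u : FreeMonoid X) :
    toMonoidAlgebra k r (wordHom k u) =
      MonoidAlgebra.single (u : (wordCon r).Quotient) 1 := by
  induction u using FreeMonoid.inductionOn' with
  | one => simp [MonoidAlgebra.one_def]
  | of_mul a u ih =>
    rw [map_mul, map_mul, ih, wordHom_of, toMonoidAlgebra, FreeAlgebra.lift_ι_apply,
      MonoidAlgebra.single_mul_single, Con.coe_mul, one_mul]

theorem toMonoidAlgebra_eq_zero {f : FreeAlgebra k X} (hf : f ∈ relationIdeal k r) :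
    toMonoidAlgebra k r f = 0 := by
  have hle : relationIdeal k r ≤ TwoSidedIdeal.ker (toMonoidAlgebra k r) := by
    refine TwoSidedIdeal.span_le.2 ?_
    rintro _ ⟨a, b, c, d, h, -, rfl⟩
    rw [SetLike.mem_coe, TwoSidedIdeal.mem_ker, map_sub, ← wordHom_pair, ← wordHom_pair,
      toMonoidAlgebra_wordHom, toMonoidAlgebra_wordHom, sub_eq_zero]
    have := wordCon_pair (r := r) (a, b)
    rw [h] at this
    rw [(Con.eq _).2 this]
  exact (TwoSidedIdeal.mem_ker _).1 (hle hf)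

/-- A word in the support of an element of the relation ideal is congruent to another word of
the support. -/
theorem exists_wordCon_of_mem {f : FreeAlgebra k X} (hf : f ∈ relationIdeal k r)
    {u : FreeMonoid X} (hu : coeff f u ≠ 0) :
    ∃ v, wordCon r v u ∧ v ≠ u ∧ coeff f v ≠ 0 := by
  classical
  by_contra! h
  apply hu
  have h0 := toMonoidAlgebra_eq_zero hf
  rw [eq_sum_coeff k f, map_finsuppSum] at h0
  -- The image of `f` in the monoid algebra vanishes. Its coefficient at the class of `u` sums the
  -- coefficients of `f` over that class, where only `u` would contribute.
  have h1 := congrArg (fun g => MonoidAlgebra.coeff g (u : (wordCon r).Quotient)) h0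
  simp only [map_smul, toMonoidAlgebra_wordHom, Finsupp.sum, MonoidAlgebra.coeff_sum,
    Finsupp.finsetSum_apply, MonoidAlgebra.coeff_smul_apply, MonoidAlgebra.coeff_single,
    MonoidAlgebra.coeff_zero, Finsupp.zero_apply] at h1
  rw [Finset.sum_eq_single u] at h1
  · simpa [coeff] using h1
  · intro v _ hvu
    by_cases hv : wordCon r v u
    · have : (FreeAlgebra.basisFreeMonoid k X).repr f v = 0 := h v hv hvu
      rw [this, zero_smul]
    · rw [Finsupp.single_eq_of_ne, smul_zero]
      intro h'
      exact hv ((Con.eq _).1 h'.symm)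
  · intro hu'
    rw [Finsupp.notMem_support_iff.1 hu', zero_smul]

variable {n : ℕ} {x : Fin n ≃ X}

/-- If `v < u` are congruent, then `u - v` lies in the ideal with leading word `u`. Conversely, if a
leading word `w` of `f` occurs in `u`, another word of the support of `f` is congruent to `w` and
smaller, and substituting it for `w` lowers `u`. -/
theorem mem_normalWords_iff {u : FreeMonoid X} :
    u ∈ normalWords x {f | f ∈ relationIdeal k r} ↔ ∀ v, wordCon r v u → ¬ DegLex x v u := by
  constructor
  · intro hu v hv hlt
    exact hu _ (wordHom_sub_mem ((wordCon r).symm hv)) u (isLM_wordHom_sub hlt) (isSubword_refl u)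
  · rintro hu f hf w hw ⟨a, b, rfl⟩
    obtain ⟨v, hvw, hne, hv⟩ := exists_wordCon_of_mem hf hw.1
    refine hu (a * v * b) ?_ ((hw.2 v hv hne).mul x a b)
    exact (wordCon r).mul ((wordCon r).mul ((wordCon r).refl a) hvw) ((wordCon r).refl b)

/-- The normal words modulo the relation ideal are the ordered monomials. -/
def HasOrderedNormalForms (r : X × X ≃ X × X) (x : Fin n ≃ X) : Prop :=
  ∀ u, u ∈ orderedMonomials x ↔ ∀ v, wordCon r v u → ¬ DegLex x v u

theorem hasOrderedNormalForms_of_normalWords_eq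
    (hN : normalWords x {f | f ∈ relationIdeal k r} = orderedMonomials x) :
    HasOrderedNormalForms r x := fun u => by
  rw [← hN, mem_normalWords_iff]

namespace HasOrderedNormalForms

variable (hN : HasOrderedNormalForms r x)
include hN

theorem eq_of_wordCon {u v : FreeMonoid X} (hu : u ∈ orderedMonomials x)
    (hv : v ∈ orderedMonomials x) (h : wordCon r u v) : u = v := by
  rcases degLex_trichotomy x u v with h' | h' | h'
  · exact absurd h' ((hN v).1 hv u h)
  · exact h'
  · exact absurd h' ((hN u).1 hu v ((wordCon r).symm h))

theorem exists_orderedMonomial (u : FreeMonoid X) :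
    ∃ v ∈ orderedMonomials x, wordCon r u v := by
  induction u using (degLex_wellFounded x).induction with
  | _ u ih =>
    by_cases hu : u ∈ orderedMonomials x
    · exact ⟨u, hu, (wordCon r).refl u⟩
    · rw [hN] at hu
      push Not at hu
      obtain ⟨v, hv, hlt⟩ := hu
      obtain ⟨w, hw, hvw⟩ := ih v hlt
      exact ⟨w, hw, (wordCon r).trans ((wordCon r).symm hv) hvw⟩

variable (hinv : IsInvolutive r)
include hinv

theorem degLex_of_descent {a b : X} (h : x.symm b < x.symm a) :
    DegLex x (FreeMonoid.of (r (a, b)).1 * FreeMonoid.of (r (a, b)).2)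
      (FreeMonoid.of a * FreeMonoid.of b) := by
  have hab : FreeMonoid.of a * FreeMonoid.of b ∉ orderedMonomials x := by
    rw [pair_mem_orderedMonomials]
    exact not_le.2 h
  rw [hN] at hab
  push Not at hab
  obtain ⟨v, hv, hlt⟩ := hab
  rcases wordCon_pair_cases hinv (p := (a, b)) ((wordCon r).symm hv) with rfl | rfl
  · exact absurd hlt (degLex_irrefl x _)
  · exact hlt

theorem le_of_fixed {a b : X} (h : r (a, b) = (a, b)) : x.symm a ≤ x.symm b := by
  by_contra hlt
  have := hN.degLex_of_descent hinv (not_le.1 hlt)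
  rw [h] at this
  exact degLex_irrefl x _ this

/-- If the image of a descent were again a descent, applying `r` twice would strictly lower the
word, although `r² = id`. -/
theorem le_of_descent {a b : X} (h : x.symm b < x.symm a) :
    x.symm (r (a, b)).1 ≤ x.symm (r (a, b)).2 := by
  by_contra hlt
  have h1 := hN.degLex_of_descent hinv (not_le.1 hlt)
  rw [Prod.mk.eta, hinv] at h1
  exact degLex_asymm x h1 (hN.degLex_of_descent hinv h)

theorem lt_of_descent {a b : X} (h : x.symm b < x.symm a) :
    x.symm (r (a, b)).1 < x.symm a := by
  rcases (degLex_pair x).1 (hN.degLex_of_descent hinv h) with h1 | ⟨h1, h2⟩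
  · exact h1
  -- With equal first letters, the second letter of `r(a, b)` would lie below `b < a`, so the image
  -- would itself be a descent.
  · have h3 := hN.le_of_descent hinv h
    rw [h1] at h3
    exact absurd (h2.trans h) (not_lt.2 h3)

end HasOrderedNormalForms

end NormalWords

end QuadraticSet

/-! ### The quadratic Gröbner basis -/

namespace QuadraticSet

open FreeGroebner

section Groebner

variable {k : Type*} [Field k] {X : Type*} {r : X × X ≃ X × X} {n : ℕ} {x : Fin n ≃ X}

theorem mem_monicRelations_iff {f : FreeAlgebra k X} :
    f ∈ monicRelations k r x ↔ ∃ p : X × X,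
      DegLex x (FreeMonoid.of (r p).1 * FreeMonoid.of (r p).2)
        (FreeMonoid.of p.1 * FreeMonoid.of p.2) ∧
      f = wordHom k (FreeMonoid.of p.1 * FreeMonoid.of p.2) -
        wordHom k (FreeMonoid.of (r p).1 * FreeMonoid.of (r p).2) := by
  constructor
  · rintro ⟨a, b, c, d, h, hlt, rfl⟩
    refine ⟨(a, b), ?_, ?_⟩ <;> simp only [h]
    · exact hlt
    · rw [wordHom_pair, wordHom_pair]
  · rintro ⟨p, hlt, rfl⟩
    exact ⟨p.1, p.2, (r p).1, (r p).2, rfl, hlt, by rw [wordHom_pair, wordHom_pair]⟩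

theorem monicRelations_finite : (monicRelations k r x).Finite := by
  have : Finite X := Finite.of_equiv _ x
  refine (Set.finite_range fun p : X × X =>
    wordHom k (FreeMonoid.of p.1 * FreeMonoid.of p.2) -
      wordHom k (FreeMonoid.of (r p).1 * FreeMonoid.of (r p).2)).subset ?_
  intro f hf
  obtain ⟨p, -, rfl⟩ := mem_monicRelations_iff.1 hf
  exact ⟨p, rfl⟩

theorem isQuadratic_of_mem_monicRelations {f : FreeAlgebra k X}
    (hf : f ∈ monicRelations k r x) : IsQuadratic f := by
  obtain ⟨p, -, rfl⟩ := mem_monicRelations_iff.1 hf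
  intro u hu
  rcases coeff_wordHom_sub_ne_zero hu with rfl | rfl <;> simp [FreeMonoid.length_mul]

theorem span_monicRelations (hinv : IsInvolutive r) :
    TwoSidedIdeal.span (monicRelations k r x) = relationIdeal k r := by
  apply le_antisymm
  · refine TwoSidedIdeal.span_le.2 ?_
    intro f hf
    obtain ⟨p, -, rfl⟩ := mem_monicRelations_iff.1 hf
    exact wordHom_sub_mem (wordCon_pair p)
  · refine TwoSidedIdeal.span_le.2 ?_
    rintro f ⟨a, b, c, d, h, hne, rfl⟩
    rw [← wordHom_pair, ← wordHom_pair]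
    rcases degLex_trichotomy x (FreeMonoid.of a * FreeMonoid.of b)
      (FreeMonoid.of c * FreeMonoid.of d) with hlt | heq | hlt
    · rw [← neg_sub]
      have h' : r (c, d) = (a, b) := by rw [← h, hinv]
      refine TwoSidedIdeal.neg_mem _ (TwoSidedIdeal.subset_span
        (mem_monicRelations_iff.2 ⟨(c, d), ?_, ?_⟩)) <;> simp only [h']
      exact hlt
    · obtain ⟨rfl, rfl⟩ := pair_injective heq
      exact absurd rfl hne
    · refine TwoSidedIdeal.subset_span
        (mem_monicRelations_iff.2 ⟨(a, b), ?_, ?_⟩) <;> simp only [h]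
      exact hlt

/-- A leading word of the ideal is not normal, hence not sorted, hence contains a descent, which is
the leading word of a monic relation. No overlaps need to be resolved. -/
theorem isGroebnerBasis_monicRelations
    (hk : normalWords x {f | f ∈ relationIdeal k r} = orderedMonomials x)
    (hinv : IsInvolutive r) :
    IsGroebnerBasis x (monicRelations k r x) (relationIdeal k r) := by
  have hN := hasOrderedNormalForms_of_normalWords_eq hk
  refine ⟨?_, span_monicRelations hinv, ?_⟩
  · intro g hg
    obtain ⟨p, hlt, rfl⟩ := mem_monicRelations_iff.1 hg
    refine ⟨_, isLM_wordHom_sub hlt, coeff_wordHom_sub_self ?_⟩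
    intro h
    rw [← h] at hlt
    exact degLex_irrefl x _ hlt
  · intro f hf u hu
    have hu' : u ∉ orderedMonomials x := by
      rw [← hk]
      exact fun h => h f hf u hu (isSubword_refl u)
    obtain ⟨a, b, hab, hsub⟩ := exists_descent hu'
    have hlt := hN.degLex_of_descent hinv hab
    exact ⟨_, mem_monicRelations_iff.2 ⟨(a, b), hlt, rfl⟩, _, isLM_wordHom_sub hlt, hsub⟩

end Groebner

/-! ### Fixed points and square-freeness -/

section SquareFree

variable {X : Type*} {r : X × X ≃ X × X}

/-- Choose `b` with `ᵃb = a` and put `r(a, b) = (a, c)`. Involutivity gives `r(a, c) = (a, b)`, so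
`ᵃc = ᵃb` and `c = b`. -/
theorem exists_fixed (hnd : IsNondegenerate r) (hinv : IsInvolutive r) (a : X) :
    ∃ b, r (a, b) = (a, b) := by
  obtain ⟨b, hb⟩ := (hnd.1 a).2 a
  have h1 : r (a, b) = (a, (r (a, b)).2) := Prod.ext hb rfl
  have h2 : r (a, (r (a, b)).2) = (a, b) := by rw [← h1, hinv]
  have h3 : (r (a, b)).2 = b := (hnd.1 a).1 (by
    simp only [leftAct] at hb ⊢
    rw [h2, hb])
  exact ⟨b, by rw [h1, h3]⟩

variable {n : ℕ} {x : Fin n ≃ X}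

theorem eq_id_of_le_of_injective {q : Fin n → Fin n} (hq : Function.Injective q)
    (hle : ∀ i, i ≤ q i) (i : Fin n) : q i = i := by
  have hsum : ∑ i : Fin n, (i : ℕ) = ∑ i : Fin n, (q i : ℕ) :=
    (Equiv.sum_comp (Equiv.ofBijective q (Finite.injective_iff_bijective.1 hq))
      fun i : Fin n => (i : ℕ)).symm
  exact (Fin.ext ((Finset.sum_eq_sum_iff_of_le fun i _ => Fin.le_def.1 (hle i)).1 hsum i
    (Finset.mem_univ i))).symm

/-- Sending `a` to the `b` with `r(a, b) = (a, b)` is injective by right non-degeneracy and never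
lowers the index, because a descent is not fixed. An injective self-map of `Fin n` with this
property is the identity. -/
theorem isSquareFree (hN : HasOrderedNormalForms r x) (hnd : IsNondegenerate r)
    (hinv : IsInvolutive r) : IsSquareFree r := by
  choose q hq using exists_fixed hnd hinv
  have hqinj : Function.Injective q := by
    intro a b hab
    refine (hnd.2 (q a)).1 ?_
    have h1 := hq a
    have h2 := hq b
    rw [← hab] at h2
    simp only [rightAct, h1, h2]
  intro a
  have := eq_id_of_le_of_injective (q := fun i => x.symm (q (x i)))
    (x.symm.injective.comp (hqinj.comp x.injective))
    (fun i => by simpa using hN.le_of_fixed hinv (hq (x i))) (x.symm a)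
  simp only [Equiv.apply_symm_apply, EmbeddingLike.apply_eq_iff_eq] at this
  have h := hq a
  rwa [this] at h

theorem eq_of_leftAct_eq (hnd : IsNondegenerate r) (hsf : IsSquareFree r) {a b : X}
    (h : (r (a, b)).1 = a) : b = a :=
  (hnd.1 a).1 (by simp only [leftAct, hsf a, h])

theorem eq_of_rightAct_eq (hnd : IsNondegenerate r) (hsf : IsSquareFree r) {a b : X}
    (h : (r (a, b)).2 = b) : a = b :=
  (hnd.2 b).1 (by simp only [rightAct, hsf b, h])

end SquareFree

/-! ### Binomial skew polynomial rings -/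

section Binomial

variable {k : Type*} [Field k] {X : Type*} {r : X × X ≃ X × X} {n : ℕ} {x : Fin n ≃ X}

/-- The indices of the letters of `r(x_j, x_i)`. -/
def relationIndices (r : X × X ≃ X × X) (x : Fin n ≃ X) (i j : Fin n) : Fin n × Fin n :=
  (x.symm (r (x j, x i)).1, x.symm (r (x j, x i)).2)

/-- The polynomial `xy - r(x, y)`. -/
noncomputable def relationPoly (k : Type*) [Field k] (r : X × X ≃ X × X) (p : X × X) :
    FreeAlgebra k X :=
  wordHom k (FreeMonoid.of p.1 * FreeMonoid.of p.2) -
    wordHom k (FreeMonoid.of (r p).1 * FreeMonoid.of (r p).2)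

theorem mem_binomialRelations_iff {f : FreeAlgebra k X} :
    f ∈ binomialRelations x (fun _ _ => 1) (relationIndices r x) ↔
      ∃ p : X × X, x.symm p.2 < x.symm p.1 ∧ f = relationPoly k r p := by
  constructor
  · rintro ⟨i, j, hij, rfl⟩
    exact ⟨(x j, x i), by simpa using hij, by
      simp [relationPoly, relationIndices, wordHom_of]⟩
  · rintro ⟨p, hp, rfl⟩
    exact ⟨x.symm p.2, x.symm p.1, hp, by
      simp [relationPoly, relationIndices, wordHom_of]⟩

theorem mem_monicRelations_iff_descent (hN : HasOrderedNormalForms r x) (hinv : IsInvolutive r)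
    {f : FreeAlgebra k X} :
    f ∈ monicRelations k r x ↔ ∃ p : X × X, x.symm p.2 < x.symm p.1 ∧ f = relationPoly k r p := by
  rw [mem_monicRelations_iff]
  refine exists_congr fun p => and_congr_left fun _ => ⟨fun h => ?_, hN.degLex_of_descent hinv⟩
  by_contra hlt
  exact (hN _).1 (pair_mem_orderedMonomials.2 (not_lt.1 hlt)) _
    ((wordCon r).symm (wordCon_pair p)) h

theorem binomialRelations_eq_monicRelations (hN : HasOrderedNormalForms r x)
    (hinv : IsInvolutive r) :
    binomialRelations x (fun _ _ => (1 : k)) (relationIndices r x) = monicRelations k r x :=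
  Set.ext fun _ => mem_binomialRelations_iff.trans (mem_monicRelations_iff_descent hN hinv).symm

/-- The leading words are the distinct two-letter descents, so none contains another and none can be
dropped; the tails are sorted and contain no descent. -/
theorem isReducedGroebnerBasis_monicRelations
    (hk : normalWords x {f | f ∈ relationIdeal k r} = orderedMonomials x)
    (hinv : IsInvolutive r) :
    IsReducedGroebnerBasis x (monicRelations k r x) (relationIdeal k r) := by
  have hN := hasOrderedNormalForms_of_normalWords_eq hk
  have hG := isGroebnerBasis_monicRelations hk hinv
  have hLM : ∀ p : X × X, x.symm p.2 < x.symm p.1 →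
      IsLM x (relationPoly k r p) (FreeMonoid.of p.1 * FreeMonoid.of p.2) :=
    fun p hp => isLM_wordHom_sub (hN.degLex_of_descent hinv hp)
  have hsub : ∀ p q : X × X, x.symm p.2 < x.symm p.1 → ∀ w, IsLM x (relationPoly k r p) w →
      IsSubword w (FreeMonoid.of q.1 * FreeMonoid.of q.2) → p = q := by
    intro p q hp w hw hsw
    obtain rfl := hw.unique (hLM p hp)
    obtain ⟨h1, h2⟩ := pair_injective
      (hsw.eq_of_length_eq (by simp only [FreeMonoid.length_mul, FreeMonoid.length_of]))
    exact Prod.ext h1 h2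
  refine ⟨hG, ?_, ?_⟩
  · intro f hf hG'
    obtain ⟨p, hp, rfl⟩ := (mem_monicRelations_iff_descent hN hinv).1 hf
    obtain ⟨g, ⟨hg, hgf⟩, w, hw, hsw⟩ := hG'.2.2 (relationPoly k r p)
      (wordHom_sub_mem (wordCon_pair p)) _ (hLM p hp)
    obtain ⟨q, hq, rfl⟩ := (mem_monicRelations_iff_descent hN hinv).1 hg
    exact hgf (by rw [hsub q p hq w hw hsw]; rfl)
  · intro f hf u hu g ⟨hg, hgf⟩ w hw hsw
    obtain ⟨p, hp, rfl⟩ := (mem_monicRelations_iff_descent hN hinv).1 hf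
    obtain ⟨q, hq, rfl⟩ := (mem_monicRelations_iff_descent hN hinv).1 hg
    rcases coeff_wordHom_sub_ne_zero hu with rfl | rfl
    · exact hgf (by rw [hsub q p hq w hw hsw]; rfl)
    · rw [hsub q (r p) hq w hw hsw] at hq
      exact absurd (hN.le_of_descent hinv hp) (not_le.2 hq)

theorem isBinomialSkewPolynomialRing
    (hk : normalWords x {f | f ∈ relationIdeal k r} = orderedMonomials x)
    (hnd : IsNondegenerate r) (hinv : IsInvolutive r) :
    IsBinomialSkewPolynomialRing x (relationIdeal k r) := by
  have hN := hasOrderedNormalForms_of_normalWords_eq hk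
  have hsf := isSquareFree hN hnd hinv
  refine ⟨fun _ _ => 1, relationIndices r x, fun _ _ _ => one_ne_zero, ?_, ?_, ?_⟩
  · intro i j hij
    have hij' : x.symm (x i) < x.symm (x j) := by simpa using hij
    refine ⟨by simpa [relationIndices] using hN.lt_of_descent hinv hij',
      lt_of_le_of_ne (hN.le_of_descent hinv hij') fun h => ?_⟩
    -- If `r(x_j, x_i)` were a diagonal pair, it would be fixed, and so would `(x_j, x_i)`, forcing
    -- `i = j`.
    have h1 : r (r (x j, x i)) = r (x j, x i) := by
      have := hsf (r (x j, x i)).1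
      rwa [show ((r (x j, x i)).1, (r (x j, x i)).1) = r (x j, x i) from
        Prod.ext rfl (x.symm.injective h)] at this
    rw [hinv] at h1
    have := eq_of_leftAct_eq hnd hsf (a := x j) (b := x i) (congrArg Prod.fst h1.symm)
    exact hij.ne (x.injective this)
  · intro i j hij
    refine ⟨x.symm (r (x i, x j)).2, x.symm (r (x i, x j)).1, ?_, ?_⟩
    -- Otherwise `x_i x_j` and its image are two congruent sorted words, hence equal; but an
    -- off-diagonal pair is not fixed.
    · by_contra hle
      have hord : FreeMonoid.of (r (x i, x j)).1 * FreeMonoid.of (r (x i, x j)).2 ∈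
          orderedMonomials x := pair_mem_orderedMonomials.2 (not_lt.1 hle)
      have heq := hN.eq_of_wordCon (pair_mem_orderedMonomials.2 (by simpa using hij.le)) hord
        (wordCon_pair (x i, x j))
      have := eq_of_leftAct_eq hnd hsf (pair_injective heq).1.symm
      exact hij.ne' (x.injective this)
    · have h := hinv (x i, x j)
      simp [relationIndices, h]
  · rw [binomialRelations_eq_monicRelations hN hinv]
    exact isReducedGroebnerBasis_monicRelations hk hinv

end Binomial

end QuadraticSet

/-! ### Orbits of a pair of involutions -/

section Involutions

variable {Ω : Type*} [DecidableEq Ω] {G H : Ω → Ω} {O : Finset Ω}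

theorem card_filter_fixed_mod_two (hG : Function.Involutive G) (hGO : ∀ w ∈ O, G w ∈ O) :
    (O.filter fun w => G w = w).card % 2 = O.card % 2 := by
  -- Modulo 2, the points moved by `G` cancel in pairs.
  have h0 : ∑ _w ∈ O.filter (fun w => ¬ G w = w), (1 : ZMod 2) = 0 := by
    refine Finset.sum_involution (fun w _ => G w) (fun _ _ => by decide) ?_ ?_ ?_
    · intro w hw _
      exact (Finset.mem_filter.1 hw).2
    · intro w hw
      obtain ⟨h1, h2⟩ := Finset.mem_filter.1 hw
      exact Finset.mem_filter.2 ⟨hGO w h1, fun h => h2 (hG.injective h)⟩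
    · intro w _
      exact hG w
  rw [Finset.sum_const, nsmul_eq_mul, mul_one, ZMod.natCast_eq_zero_iff] at h0
  have := Finset.card_filter_add_card_filter_not (s := O) (fun w => G w = w)
  omega

/-- Without fixed points the orbits of two involutions are even cycles. Cycles of length 2 or 4
would make `G` and `H` commute, so a hexagon is the smallest possibility, and closing up as a
hexagon is the braid relation. -/
theorem braid_of_card_orbit_le_six {w : Ω} (hG : Function.Involutive G)
    (hH : Function.Involutive H) (hGO : ∀ w ∈ O, G w ∈ O) (hHO : ∀ w ∈ O, H w ∈ O)
    (h : ∀ w ∈ O, G (H w) ≠ H (G w)) (hGf : ∀ w ∈ O, G w ≠ w) (hHf : ∀ w ∈ O, H w ≠ w)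
    (hw : w ∈ O) : 6 ≤ O.card ∧ (O.card = 6 → G (H (G w)) = H (G (H w))) := by
  have a1 := hGf w hw
  have a2 := hHf w hw
  have m1 := hGO w hw
  have m2 := hHO w hw
  have m3 := hGO _ m2
  have m4 := hHO _ m1
  have m5 := hGO _ m4
  have m6 := hHO _ m3
  have b1 := hHf _ m1
  have b2 := hGf _ m2
  have b3 := hHf _ m3
  have b4 := hGf _ m4
  have b5 := hGf _ m6
  have c0 := h w hw
  have c1 : G w ≠ H w := by
    intro e
    apply c0
    rw [← e, hG, e, hH]
  have i1 : ∀ u v, G u = v ↔ u = G v := fun u v =>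
    ⟨fun e => by rw [← e, hG], fun e => by rw [e, hG]⟩
  have i2 : ∀ u v, H u = v ↔ u = H v := fun u v =>
    ⟨fun e => by rw [← e, hH], fun e => by rw [e, hH]⟩
  have d1 : w ≠ G (H w) := fun e => c1 ((i1 _ _).2 e)
  have d2 : w ≠ H (G w) := fun e => c1 ((i2 _ _).2 e).symm
  have d3 : w ≠ G (H (G w)) := fun e => b1 ((i1 _ _).1 e.symm)
  have d4 : G w ≠ G (H w) := fun e => a2 (hG.injective e).symm
  have d5 : G w ≠ G (H (G w)) := fun e => d2 (hG.injective e)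
  have d6 : H w ≠ H (G w) := fun e => a1 (hH.injective e).symm
  have d7 : H w ≠ G (H (G w)) := fun e => c0 ((i1 _ _).1 e.symm).symm
  have d8 : G (H w) ≠ G (H (G w)) := fun e => d6 (hG.injective e)
  have hsub : ({w, G w, H w, G (H w), H (G w), G (H (G w))} : Finset Ω) ⊆ O := by
    intro v hv
    simp only [Finset.mem_insert, Finset.mem_singleton] at hv
    rcases hv with rfl | rfl | rfl | rfl | rfl | rfl <;> assumption
  have hcard : ({w, G w, H w, G (H w), H (G w), G (H (G w))} : Finset Ω).card = 6 := by
    rw [Finset.card_insert_of_notMem, Finset.card_insert_of_notMem, Finset.card_insert_of_notMem,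
      Finset.card_insert_of_notMem, Finset.card_insert_of_notMem, Finset.card_singleton] <;>
    simp only [Finset.mem_insert, Finset.mem_singleton, not_or]
    · exact b4.symm
    · exact ⟨c0, d8⟩
    · exact ⟨b2.symm, d6, d7⟩
    · exact ⟨c1, d4, b1.symm, d5⟩
    · exact ⟨a1.symm, a2.symm, d1, d2, d3⟩
  refine ⟨hcard ▸ Finset.card_le_card hsub, fun h6 => ?_⟩
  have heq := Finset.eq_of_subset_of_card_le hsub (by rw [hcard, h6])
  rw [← heq] at m6
  simp only [Finset.mem_insert, Finset.mem_singleton] at m6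
  -- `H (G (H w))` must be one of the six listed points; every option but `G (H (G w))` contradicts
  -- their distinctness.
  rcases m6 with e | e | e | e | e | e
  · exact absurd ((i2 _ _).1 e) b2
  · exact absurd ((i2 _ _).1 e) c0
  · exact absurd (hH.injective e).symm d1
  · exact absurd e b3
  · exact absurd (hH.injective e).symm d4
  · exact e.symm

/-- An orbit with a fixed point is a path. Starting at `w`, non-commutation yields three distinct
vertices; if there are no more, the path ends in a fixed point of `H`. -/
theorem braid_of_card_path_le_three {w : Ω} (hG : Function.Involutive G)
    (hH : Function.Involutive H) (hGO : ∀ w ∈ O, G w ∈ O) (hHO : ∀ w ∈ O, H w ∈ O)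
    (h : ∀ w ∈ O, G (H w) ≠ H (G w)) (hw : w ∈ O) (hGw : G w = w) :
    3 ≤ O.card ∧ (O.card = 3 → ∀ v ∈ O, G (H (G v)) = H (G (H v))) := by
  have m2 := hHO w hw
  have m3 := hGO _ m2
  have m6 := hHO _ m3
  have c0 := h w hw
  rw [hGw] at c0
  have a2 : w ≠ H w := by
    intro e
    rw [← e] at c0
    exact c0 hGw
  have d1 : w ≠ G (H w) := by
    intro e
    apply a2
    rw [← hG (H w), ← e, hGw]
  have hsub : ({w, H w, G (H w)} : Finset Ω) ⊆ O := by
    intro v hv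
    simp only [Finset.mem_insert, Finset.mem_singleton] at hv
    rcases hv with rfl | rfl | rfl <;> assumption
  have hcard : ({w, H w, G (H w)} : Finset Ω).card = 3 :=
    Finset.card_eq_three.2 ⟨_, _, _, a2, d1, c0.symm, rfl⟩
  refine ⟨hcard ▸ Finset.card_le_card hsub, fun h3 => ?_⟩
  have heq := Finset.eq_of_subset_of_card_le hsub (by rw [hcard, h3])
  rw [← heq] at m6
  simp only [Finset.mem_insert, Finset.mem_singleton] at m6
  have hfix : H (G (H w)) = G (H w) := by
    rcases m6 with e | e | e
    · exact absurd (by rw [← hH (G (H w)), e]) c0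
    · exact absurd (hH.injective e).symm d1
    · exact e
  intro v hv
  rw [← heq] at hv
  simp only [Finset.mem_insert, Finset.mem_singleton] at hv
  rcases hv with rfl | rfl | rfl
  · rw [hGw, hfix]
  · rw [hH, hGw, hfix, hG]
  · rw [hfix, hG, hH, hGw]

/-- A set stable under two involutions which nowhere commute has at least the weight of
a hexagon, or of a path with three vertices; in case of equality the braid relation holds. -/
theorem weight_of_stable (hG : Function.Involutive G)
    (hH : Function.Involutive H) (hGO : ∀ w ∈ O, G w ∈ O) (hHO : ∀ w ∈ O, H w ∈ O)
    (h : ∀ w ∈ O, G (H w) ≠ H (G w)) (hO : O.Nonempty) :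
    12 ≤ 2 * O.card + 3 * ((O.filter fun w => G w = w).card + (O.filter fun w => H w = w).card) ∧
    (2 * O.card + 3 * ((O.filter fun w => G w = w).card + (O.filter fun w => H w = w).card) = 12 →
      ∀ v ∈ O, G (H (G v)) = H (G (H v))) := by
  -- Parity completes the count when there is a fixed point: with three points both involutions have
  -- a fixed point, giving at least `6 + 6`; with four, the fixed points of one involution number at
  -- least two, giving at least `8 + 6`; with five or more, `10 + 3` already exceeds 12.
  have p1 := card_filter_fixed_mod_two hG hGO
  have p2 := card_filter_fixed_mod_two hH hHO
  by_cases hGf : ∃ w ∈ O, G w = w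
  · obtain ⟨w, hw, hGw⟩ := hGf
    have h1 : 0 < (O.filter fun w => G w = w).card :=
      Finset.card_pos.2 ⟨w, Finset.mem_filter.2 ⟨hw, hGw⟩⟩
    obtain ⟨h2, h3⟩ := braid_of_card_path_le_three hG hH hGO hHO h hw hGw
    exact ⟨by omega, fun e => h3 (by omega)⟩
  by_cases hHf : ∃ w ∈ O, H w = w
  · obtain ⟨w, hw, hHw⟩ := hHf
    have h1 : 0 < (O.filter fun w => H w = w).card :=
      Finset.card_pos.2 ⟨w, Finset.mem_filter.2 ⟨hw, hHw⟩⟩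
    obtain ⟨h2, h3⟩ := braid_of_card_path_le_three hH hG hHO hGO
      (fun w hw => (h w hw).symm) hw hHw
    exact ⟨by omega, fun e v hv => (h3 (by omega) v hv).symm⟩
  push Not at hGf hHf
  obtain ⟨w, hw⟩ := hO
  have h6 := fun v hv => braid_of_card_orbit_le_six (w := v) hG hH hGO hHO h hGf hHf hv
  have := (h6 w hw).1
  exact ⟨by omega, fun e v hv => (h6 v hv).2 (by omega)⟩

end Involutions

/-- The number of weakly increasing triples. -/
theorem six_mul_card_sorted_triples (n : ℕ) :
    6 * (Finset.univ.filter fun t : Fin n × Fin n × Fin n => t.1 ≤ t.2.1 ∧ t.2.1 ≤ t.2.2).card =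
      n * (n + 1) * (n + 2) := by
  have h : (Finset.univ.filter fun t : Fin n × Fin n × Fin n => t.1 ≤ t.2.1 ∧ t.2.1 ≤ t.2.2).card =
      -- The triples are listed by largest, middle, then smallest entry.
      ((Finset.range n).sigma fun k => (Finset.range (k + 1)).sigma
        fun j => Finset.range (j + 1)).card := by
    refine Finset.card_bij (fun t _ => ⟨t.2.2, t.2.1, t.1⟩) ?_ ?_ ?_
    · rintro ⟨i, j, k⟩ ht
      simp only [Finset.mem_filter, Finset.mem_univ, true_and, Fin.le_def] at ht
      simp only [Finset.mem_sigma, Finset.mem_range]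
      omega
    · rintro ⟨i, j, k⟩ _ ⟨i', j', k'⟩ _ h
      simp only [Sigma.mk.injEq, heq_eq_eq, Fin.val_inj] at h
      obtain ⟨rfl, rfl, rfl⟩ := h
      rfl
    · rintro ⟨k, j, i⟩ ht
      simp only [Finset.mem_sigma, Finset.mem_range] at ht
      refine ⟨(⟨i, by omega⟩, ⟨j, by omega⟩, ⟨k, by omega⟩), ?_, rfl⟩
      simp only [Finset.mem_filter, Finset.mem_univ, true_and, Fin.mk_le_mk]
      omega
  rw [h]
  simp only [Finset.card_sigma, Finset.card_range]
  have h2 : ∀ k, 2 * ∑ j ∈ Finset.range k, (j + 1) = k * (k + 1) := by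
    intro k
    induction k with
    | zero => rfl
    | succ k ih => rw [Finset.sum_range_succ, mul_add, ih]; ring
  clear h
  induction n with
  | zero => rfl
  | succ n ih =>
    rw [Finset.sum_range_succ, mul_add, ih]
    have := h2 (n + 1)
    linear_combination 3 * this

/-! ### The Yang–Baxter equation -/

namespace QuadraticSet

open FreeGroebner

section YangBaxter

variable {X : Type*} {r : X × X ≃ X × X} {n : ℕ} {x : Fin n ≃ X}

/-- The word with three given letters. -/
def tripleWord (t : X × X × X) : FreeMonoid X :=
  FreeMonoid.of t.1 * FreeMonoid.of t.2.1 * FreeMonoid.of t.2.2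

theorem tripleWord_injective : Function.Injective (tripleWord (X := X)) := by
  rintro ⟨a, b, c⟩ ⟨a', b', c'⟩ h
  have := congrArg FreeMonoid.toList h
  simpa [tripleWord] using this

theorem exists_tripleWord {u : FreeMonoid X} (hu : u.length = 3) : ∃ t, tripleWord t = u := by
  obtain ⟨a, b, c, h⟩ := List.length_eq_three.1 (show u.toList.length = 3 from hu)
  refine ⟨(a, b, c), FreeMonoid.toList.injective ?_⟩
  rw [h]
  rfl

theorem wordCon_r12 (t : X × X × X) : wordCon r (tripleWord t) (tripleWord (r12 r t)) :=
  (wordCon r).mul (wordCon_pair (t.1, t.2.1)) ((wordCon r).refl _)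

theorem wordCon_r23 (t : X × X × X) : wordCon r (tripleWord t) (tripleWord (r23 r t)) := by
  have := (wordCon r).mul ((wordCon r).refl (FreeMonoid.of t.1)) (wordCon_pair (r := r) t.2)
  simp only [← mul_assoc] at this
  exact this

theorem r12_involutive (hinv : IsInvolutive r) : Function.Involutive (r12 r) := by
  rintro ⟨a, b, c⟩
  have := hinv (a, b)
  simp [r12, this]

theorem r23_involutive (hinv : IsInvolutive r) : Function.Involutive (r23 r) := by
  rintro ⟨a, b, c⟩
  have := hinv (b, c)
  simp [r23, this]

theorem r12_eq_self_iff (hnd : IsNondegenerate r) (hsf : IsSquareFree r) {t : X × X × X} :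
    r12 r t = t ↔ t.1 = t.2.1 := by
  constructor
  · intro h
    have h' : (r (t.1, t.2.1)).1 = t.1 := congrArg Prod.fst h
    exact (eq_of_leftAct_eq hnd hsf h').symm
  · obtain ⟨a, b, c⟩ := t
    intro h
    obtain rfl : a = b := h
    simp [r12, hsf a]

theorem r23_eq_self_iff (hnd : IsNondegenerate r) (hsf : IsSquareFree r) {t : X × X × X} :
    r23 r t = t ↔ t.2.1 = t.2.2 := by
  constructor
  · intro h
    have h' : (r (t.2.1, t.2.2)).1 = t.2.1 := congrArg (fun s => s.2.1) h
    exact (eq_of_leftAct_eq hnd hsf h').symm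
  · obtain ⟨a, b, c⟩ := t
    intro h
    obtain rfl : b = c := h
    simp [r23, hsf b]

/-- For `t = (a, b, c)`, comparing first entries gives `ᵃ(ᵇc) = ᵃb`, so `ᵇc = b` and `c = b`; the
last entries give `a = b` in the same way. -/
theorem eq_diagonal_of_commute (hnd : IsNondegenerate r) (hsf : IsSquareFree r) {t : X × X × X}
    (h : r12 r (r23 r t) = r23 r (r12 r t)) : t = (t.1, t.1, t.1) := by
  obtain ⟨a, b, c⟩ := t
  have h1 : leftAct r a (r (b, c)).1 = leftAct r a b := (congrArg Prod.fst h :)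
  have h2 : rightAct r c b = rightAct r c (r (a, b)).2 :=
    (congrArg (fun s => s.2.2) h :)
  replace h1 := (hnd.1 a).1 h1
  replace h2 := (hnd.2 c).1 h2
  obtain rfl := eq_of_leftAct_eq hnd hsf h1
  obtain rfl := eq_of_rightAct_eq hnd hsf h2.symm
  rfl

/-- The fibres of `nf` are the classes of three-letter words, indexed by sorted triples; the last
clause makes each such fibre nonempty. -/
theorem exists_normal_triple (hN : HasOrderedNormalForms r x) :
    ∃ nf : X × X × X → Fin n × Fin n × Fin n,
      (∀ t, (nf t).1 ≤ (nf t).2.1 ∧ (nf t).2.1 ≤ (nf t).2.2) ∧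
      (∀ t t', wordCon r (tripleWord t) (tripleWord t') → nf t = nf t') ∧
      ∀ i j l, i ≤ j → j ≤ l → nf (x i, x j, x l) = (i, j, l) := by
  have hex : ∀ t : X × X × X, ∃ s : X × X × X,
      tripleWord s ∈ orderedMonomials x ∧ wordCon r (tripleWord t) (tripleWord s) := by
    intro t
    obtain ⟨v, hv, htv⟩ := hN.exists_orderedMonomial (tripleWord t)
    obtain ⟨s, rfl⟩ := exists_tripleWord (u := v) (by
      rw [← wordCon_length htv]
      simp [tripleWord, FreeMonoid.length_mul])
    exact ⟨s, hv, htv⟩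
  choose nf h1 h2 using hex
  have h3 : ∀ t s, tripleWord s ∈ orderedMonomials x → wordCon r (tripleWord t) (tripleWord s) →
      nf t = s := fun t s hs hts => tripleWord_injective
    (hN.eq_of_wordCon (h1 t) hs ((wordCon r).trans ((wordCon r).symm (h2 t)) hts))
  refine ⟨fun t => (x.symm (nf t).1, x.symm (nf t).2.1, x.symm (nf t).2.2), ?_, ?_, ?_⟩
  · exact fun t => triple_mem_orderedMonomials.1 (h1 t)
  · intro t t' h
    simp only [h3 t (nf t') (h1 t') ((wordCon r).trans h (h2 t'))]
  · intro i j l hij hjl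
    have := h3 (x i, x j, x l) (x i, x j, x l)
      (triple_mem_orderedMonomials.2 (by simpa using ⟨hij, hjl⟩)) ((wordCon r).refl _)
    simp [this]

theorem satisfiesYBE (hN : HasOrderedNormalForms r x) (hnd : IsNondegenerate r)
    (hinv : IsInvolutive r) : SatisfiesYBE r := by
  classical
  have : Fintype X := Fintype.ofEquiv _ x
  have hX : Fintype.card X = n := by
    rw [← Fintype.card_congr x, Fintype.card_fin]
  have hsf := isSquareFree hN hnd hinv
  have hG := r12_involutive hinv
  have hH := r23_involutive hinv
  obtain ⟨nf, hnf, hnfc, hnfs⟩ := exists_normal_triple hN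
  have hnfG : ∀ t, nf (r12 r t) = nf t := fun t => (hnfc _ _ (wordCon_r12 t)).symm
  have hnfH : ∀ t, nf (r23 r t) = nf t := fun t => (hnfc _ _ (wordCon_r23 t)).symm
  let M := Finset.univ.filter fun t : Fin n × Fin n × Fin n => t.1 ≤ t.2.1 ∧ t.2.1 ≤ t.2.2
  let O : Fin n × Fin n × Fin n → Finset (X × X × X) := fun m =>
    Finset.univ.filter fun t => nf t = m
  let D : Fin n × Fin n × Fin n → Prop := fun m => m.1 = m.2.1 ∧ m.2.1 = m.2.2
  -- The factors 2 and 3 give a hexagon without fixed points and a three-vertex path with two fixed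
  -- ends the same weight 12; a single diagonal triple weighs `2 + 3 + 3 = 8`.
  let W : Fin n × Fin n × Fin n → ℕ := fun m => 2 * (O m).card +
    3 * (((O m).filter fun t => r12 r t = t).card + ((O m).filter fun t => r23 r t = t).card)
  have hM : ∀ t, nf t ∈ M := fun t => Finset.mem_filter.2 ⟨Finset.mem_univ _, hnf t⟩
  have hmO : ∀ {t m}, t ∈ O m ↔ nf t = m := fun {t m} => by simp [O]
  have hdiag : ∀ a : X, nf (a, a, a) = (x.symm a, x.symm a, x.symm a) := fun a => by
    simpa using hnfs (x.symm a) (x.symm a) (x.symm a) le_rfl le_rfl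
  have hnd_case : ∀ m ∈ M, ¬ D m → 12 ≤ W m ∧ (W m = 12 → ∀ t ∈ O m,
      r12 r (r23 r (r12 r t)) = r23 r (r12 r (r23 r t))) := by
    rintro ⟨i, j, l⟩ hm hD
    refine weight_of_stable hG hH ?_ ?_ ?_ ?_
    · exact fun t ht => hmO.2 ((hnfG t).trans (hmO.1 ht))
    · exact fun t ht => hmO.2 ((hnfH t).trans (hmO.1 ht))
    · intro t ht hc
      rw [hmO, eq_diagonal_of_commute hnd hsf hc, hdiag] at ht
      simp only [Prod.mk.injEq] at ht
      exact hD ⟨ht.1.symm.trans ht.2.1, ht.2.1.symm.trans ht.2.2⟩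
    · obtain ⟨-, h1, h2⟩ := Finset.mem_filter.1 hm
      exact ⟨(x i, x j, x l), hmO.2 (hnfs i j l h1 h2)⟩
  have hd_case : ∀ m ∈ M, D m → 8 ≤ W m ∧ (W m = 8 → ∀ t ∈ O m, t = (t.1, t.1, t.1)) := by
    rintro ⟨i, j, l⟩ hm ⟨h1, h2⟩
    simp only at h1 h2
    subst h1 h2
    have hmem : (x i, x i, x i) ∈ O (i, i, i) := hmO.2 (hnfs i i i le_rfl le_rfl)
    have c1 : 0 < (O (i, i, i)).card := Finset.card_pos.2 ⟨_, hmem⟩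
    have c2 : 0 < ((O (i, i, i)).filter fun t => r12 r t = t).card :=
      Finset.card_pos.2 ⟨_, Finset.mem_filter.2 ⟨hmem, (r12_eq_self_iff hnd hsf).2 rfl⟩⟩
    have c3 : 0 < ((O (i, i, i)).filter fun t => r23 r t = t).card :=
      Finset.card_pos.2 ⟨_, Finset.mem_filter.2 ⟨hmem, (r23_eq_self_iff hnd hsf).2 rfl⟩⟩
    refine ⟨by simp only [W]; omega, fun hW t ht => ?_⟩
    have hc : (O (i, i, i)).card ≤ 1 := by
      simp only [W] at hW
      omega
    rw [Finset.card_le_one.1 hc t ht _ hmem]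
  have hfixG : (Finset.univ.filter fun t : X × X × X => r12 r t = t).card = n * n := by
    have : (Finset.univ.filter fun t : X × X × X => r12 r t = t) =
        Finset.univ.image fun p : X × X => (p.1, p.1, p.2) := by
      ext ⟨a, b, c⟩
      simp [r12_eq_self_iff hnd hsf, eq_comm]
    rw [this, Finset.card_image_of_injective, Finset.card_univ, Fintype.card_prod, hX]
    rintro ⟨a, b⟩ ⟨c, d⟩ h
    simp_all
  have hfixH : (Finset.univ.filter fun t : X × X × X => r23 r t = t).card = n * n := by
    have : (Finset.univ.filter fun t : X × X × X => r23 r t = t) =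
        Finset.univ.image fun p : X × X => (p.1, p.2, p.2) := by
      ext ⟨a, b, c⟩
      simp [r23_eq_self_iff hnd hsf, eq_comm]
    rw [this, Finset.card_image_of_injective, Finset.card_univ, Fintype.card_prod, hX]
    rintro ⟨a, b⟩ ⟨c, d⟩ h
    simp_all
  have hall : (Finset.univ : Finset (X × X × X)).card = n * (n * n) := by
    rw [Finset.card_univ, Fintype.card_prod, Fintype.card_prod, hX]
  have hsumW : ∑ m ∈ M, W m = 2 * (n * (n * n)) + 3 * (n * n + n * n) := by
    simp only [W]
    rw [Finset.sum_add_distrib, ← Finset.mul_sum, ← Finset.mul_sum, Finset.sum_add_distrib,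
      ← hall, Finset.card_eq_sum_card_fiberwise (t := M) fun t _ => hM t]
    congr 2
    conv_rhs =>
      congr
      · rw [← hfixG, Finset.card_eq_sum_card_fiberwise (t := M) fun t _ => hM t]
      · rw [← hfixH, Finset.card_eq_sum_card_fiberwise (t := M) fun t _ => hM t]
    simp only [O, Finset.filter_filter, and_comm]
  have hDcard : (M.filter D).card = n := by
    have : M.filter D = Finset.univ.image fun i : Fin n => (i, i, i) := by
      ext ⟨i, j, l⟩
      simp only [M, D, Finset.mem_filter, Finset.mem_univ, true_and, Finset.mem_image,
        Prod.mk.injEq]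
      constructor
      · rintro ⟨-, rfl, rfl⟩
        exact ⟨i, rfl, rfl, rfl⟩
      · rintro ⟨a, rfl, rfl, rfl⟩
        simp
    rw [this, Finset.card_image_of_injective, Finset.card_univ, Fintype.card_fin]
    intro i j h
    exact congrArg Prod.fst h
  -- The numerical coincidence behind the proof: `12 · n(n+1)(n+2)/6 - 4n = 2n³ + 6n²`.
  have hsumb : ∑ m ∈ M, (if D m then 8 else 12) = ∑ m ∈ M, W m := by
    have h1 := six_mul_card_sorted_triples n
    have h2 := Finset.card_filter_add_card_filter_not (s := M) D
    rw [hsumW, Finset.sum_ite, Finset.sum_const, Finset.sum_const, smul_eq_mul, smul_eq_mul,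
      hDcard]
    rw [hDcard] at h2
    change 6 * M.card = _ at h1
    nlinarith
  have heq := (Finset.sum_eq_sum_iff_of_le (s := M) fun m hm => by
    by_cases hD : D m
    · rw [if_pos hD]
      exact (hd_case m hm hD).1
    · rw [if_neg hD]
      exact (hnd_case m hm hD).1).1 hsumb
  funext t
  change r12 r (r23 r (r12 r t)) = r23 r (r12 r (r23 r t))
  have hm := heq (nf t) (hM t)
  by_cases hD : D (nf t)
  · rw [if_pos hD] at hm
    have ht := (hd_case _ (hM t) hD).2 hm.symm t (hmO.2 rfl)
    have f1 : r12 r t = t := (r12_eq_self_iff hnd hsf).2 (by rw [ht])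
    have f2 : r23 r t = t := (r23_eq_self_iff hnd hsf).2 (by rw [ht])
    rw [f1, f2, f1, f2]
  · rw [if_neg hD] at hm
    exact (hnd_case _ (hM t) hD).2 hm.symm t (hmO.2 rfl)

end YangBaxter

end QuadraticSet

/-! ### Algebras that are finite over a commutative subalgebra -/

section Noetherian

variable {k : Type*} [Field k] {B : Type*} [Ring B] [Algebra k B] {s T W : Set B}

open scoped IsMulCommutative in
/-- An algebra spanned by products `p * t`, with `p` a monomial in finitely many commuting
elements and `t` in a finite set, is left Noetherian. -/
theorem isNoetherianRing_of_commuting (hs : s.Finite)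
    (hcomm : ∀ a ∈ s, ∀ b ∈ s, a * b = b * a) (hT : T.Finite)
    (hW : Submodule.span k W = ⊤)
    (hdecomp : ∀ w ∈ W, ∃ p ∈ Submonoid.closure s, ∃ t ∈ T, w = p * t) :
    IsNoetherianRing B := by
  have := Algebra.isMulCommutative_adjoin k hcomm
  have hfg : (Algebra.adjoin k s).FG := by
    have := Subalgebra.fg_adjoin_finset (R := k) hs.toFinset
    rwa [hs.coe_toFinset] at this
  have hft : Algebra.FiniteType k (Algebra.adjoin k s) :=
    (Subalgebra.fg_iff_finiteType _).1 hfg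
  -- Hilbert's basis theorem, for the commutative algebra generated by `s`.
  have hR : IsNoetherianRing (Algebra.adjoin k s) :=
    Algebra.FiniteType.isNoetherianRing k (Algebra.adjoin k s)
  have hfin : Module.Finite (Algebra.adjoin k s) B := by
    refine ⟨Submodule.fg_def.2 ⟨T, hT, ?_⟩⟩
    have hle : Submodule.span k W ≤
        (Submodule.span (Algebra.adjoin k s) T).restrictScalars k := by
      refine Submodule.span_le.2 fun w hw => ?_
      obtain ⟨p, hp, t, ht, rfl⟩ := hdecomp w hw
      have hp' : p ∈ Algebra.adjoin k s :=
        (Submonoid.closure_le (S := (Algebra.adjoin k s).toSubmonoid)).2 Algebra.subset_adjoin hp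
      exact Submodule.smul_mem _ (⟨p, hp'⟩ : Algebra.adjoin k s) (Submodule.subset_span ht)
    rw [hW] at hle
    exact eq_top_iff.2 fun b _ => hle trivial
  exact isNoetherian_of_tower (Algebra.adjoin k s)
    (isNoetherian_of_isNoetherianRing_of_finite (Algebra.adjoin k s) B)

theorem isNoetherianRing_op_of_commuting (hs : s.Finite)
    (hcomm : ∀ a ∈ s, ∀ b ∈ s, a * b = b * a) (hT : T.Finite)
    (hW : Submodule.span k W = ⊤)
    (hdecomp : ∀ w ∈ W, ∃ p ∈ Submonoid.closure s, ∃ t ∈ T, w = t * p) :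
    IsNoetherianRing Bᵐᵒᵖ := by
  refine isNoetherianRing_of_commuting (k := k) (s := MulOpposite.unop ⁻¹' s)
    (T := MulOpposite.unop ⁻¹' T) (W := MulOpposite.op '' W)
    (hs.preimage MulOpposite.unop_injective.injOn) ?_
    (hT.preimage MulOpposite.unop_injective.injOn) ?_ ?_
  · exact fun a ha b hb => MulOpposite.unop_injective (hcomm _ hb _ ha)
  · have := congrArg (Submodule.map (MulOpposite.opLinearEquiv k : B ≃ₗ[k] Bᵐᵒᵖ).toLinearMap) hW
    rw [Submodule.map_span, Submodule.map_top, LinearEquiv.range] at this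
    exact this
  · rintro _ ⟨w, hw, rfl⟩
    obtain ⟨p, hp, t, ht, rfl⟩ := hdecomp w hw
    refine ⟨MulOpposite.op p, ?_, MulOpposite.op t, ht, MulOpposite.op_mul _ _⟩
    rw [← Submonoid.op_closure]
    exact hp

end Noetherian

/-! ### Powers of the generators -/

namespace QuadraticSet

open FreeGroebner

section Powers

variable {X : Type*} {r : X × X ≃ X × X}

/-- The cyclic condition. -/
theorem leftAct_rightAct (hnd : IsNondegenerate r) (hsf : IsSquareFree r)
    (hybe : SatisfiesYBE r) (a b : X) :
    leftAct r (rightAct r a b) a = leftAct r b a := by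
  -- At `(b, a, a)` the first `r23` on the right does nothing. With `c = ᵇa` and `d = ^(bᵃ)a`, the
  -- first entries give `ᶜd = c`, hence `d = c`.
  have h := congrFun hybe (b, a, a)
  simp only [Function.comp_apply, r12, r23, hsf a] at h
  have h1 : (r ((r (b, a)).1, (r ((r (b, a)).2, a)).1)).1 = (r (b, a)).1 :=
    (congrArg Prod.fst h :)
  exact eq_of_leftAct_eq hnd hsf h1

theorem iterate_card_perm {f : X → X} (hf : Function.Bijective f) (a : X) :
    f^[Nat.card (Equiv.Perm X)] a = a := by
  calc f^[Nat.card (Equiv.Perm X)] a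
      = (Equiv.ofBijective f hf ^ Nat.card (Equiv.Perm X)) a := by
        rw [Equiv.Perm.coe_pow]
        rfl
    _ = a := by rw [pow_card_eq_one', Equiv.Perm.one_apply]

variable {M : Type*} [Monoid M] {y : X → M}
  (hy : ∀ a b, y a * y b = y (leftAct r a b) * y (rightAct r b a))
include hy

/-- By the cyclic condition, moving `y b` past successive copies of `y a` always produces the same
letter `ᵇa`, although `b` itself changes. -/
theorem mul_pow_generator (hnd : IsNondegenerate r) (hsf : IsSquareFree r)
    (hybe : SatisfiesYBE r) (a b : X) (j : ℕ) :
    y b * y a ^ j = y (leftAct r b a) ^ j * y ((rightAct r a)^[j] b) := by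
  induction j generalizing b with
  | zero => simp
  | succ j ih =>
    rw [pow_succ', ← mul_assoc, hy, mul_assoc, ih, leftAct_rightAct hnd hsf hybe, ← mul_assoc,
      ← pow_succ', Function.iterate_succ_apply]

variable {m : ℕ} (hm : m = Nat.card (Equiv.Perm X))
  (hnd : IsNondegenerate r) (hsf : IsSquareFree r) (hybe : SatisfiesYBE r)
include hm hnd hsf hybe

/-- The exponent `m` is the order of the symmetric group on `X`, so the `m`-th iterate of every
`ℛ_a` and `ℒ_b` is the identity. -/
theorem mul_pow_card_perm (a b : X) :
    y b * y a ^ m = y (leftAct r b a) ^ m * y b := by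
  rw [mul_pow_generator hy hnd hsf hybe, hm, iterate_card_perm (hnd.2 a)]

theorem pow_mul_pow_card_perm (a b : X) (j : ℕ) :
    y b ^ j * y a ^ m = y ((leftAct r b)^[j] a) ^ m * y b ^ j := by
  induction j with
  | zero => simp
  | succ j ih =>
    rw [pow_succ', mul_assoc, ih, ← mul_assoc, mul_pow_card_perm hy hm hnd hsf hybe, mul_assoc,
      Function.iterate_succ_apply']

theorem pow_card_perm_commute (a b : X) : y b ^ m * y a ^ m = y a ^ m * y b ^ m := by
  rw [pow_mul_pow_card_perm hy hm hnd hsf hybe, hm, iterate_card_perm (hnd.1 b)]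

theorem exists_generator_mul (b : X) {p : M}
    (hp : p ∈ Submonoid.closure (Set.range fun a => y a ^ m)) :
    ∃ p' ∈ Submonoid.closure (Set.range fun a => y a ^ m), y b * p = p' * y b := by
  induction hp using Submonoid.closure_induction with
  | mem q hq =>
    obtain ⟨a, rfl⟩ := hq
    exact ⟨_, Submonoid.subset_closure ⟨leftAct r b a, rfl⟩,
      mul_pow_card_perm hy hm hnd hsf hybe a b⟩
  | one => exact ⟨1, one_mem _, by simp⟩
  | mul q₁ q₂ _ _ ih₁ ih₂ =>
    obtain ⟨p₁, h₁, e₁⟩ := ih₁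
    obtain ⟨p₂, h₂, e₂⟩ := ih₂
    exact ⟨p₁ * p₂, mul_mem h₁ h₂, by rw [← mul_assoc, e₁, mul_assoc, e₂, mul_assoc]⟩

theorem exists_mul_generator (b : X) {p : M}
    (hp : p ∈ Submonoid.closure (Set.range fun a => y a ^ m)) :
    ∃ p' ∈ Submonoid.closure (Set.range fun a => y a ^ m), p * y b = y b * p' := by
  induction hp using Submonoid.closure_induction with
  | mem q hq =>
    obtain ⟨a, rfl⟩ := hq
    -- Moving a power to the right inverts `ℒ_b`, hence the need for surjectivity.
    obtain ⟨c, rfl⟩ := (hnd.1 b).2 a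
    exact ⟨y c ^ m, Submonoid.subset_closure (Set.mem_range_self c),
      (mul_pow_card_perm hy hm hnd hsf hybe c b).symm⟩
  | one => exact ⟨1, one_mem _, by simp⟩
  | mul q₁ q₂ _ _ ih₁ ih₂ =>
    obtain ⟨p₁, h₁, e₁⟩ := ih₁
    obtain ⟨p₂, h₂, e₂⟩ := ih₂
    exact ⟨p₁ * p₂, mul_mem h₁ h₂, by rw [mul_assoc, e₂, ← mul_assoc, e₁, mul_assoc]⟩

theorem exists_pow_generator_mul (b : X) (j : ℕ) {p : M}
    (hp : p ∈ Submonoid.closure (Set.range fun a => y a ^ m)) :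
    ∃ p' ∈ Submonoid.closure (Set.range fun a => y a ^ m), y b ^ j * p = p' * y b ^ j := by
  induction j with
  | zero => exact ⟨p, hp, by simp⟩
  | succ j ih =>
    obtain ⟨p₁, h₁, e₁⟩ := ih
    obtain ⟨p₂, h₂, e₂⟩ := exists_generator_mul hy hm hnd hsf hybe b h₁
    exact ⟨p₂, h₂, by rw [pow_succ', mul_assoc, e₁, ← mul_assoc, e₂, mul_assoc]⟩

theorem exists_mul_pow_generator (b : X) (j : ℕ) {p : M}
    (hp : p ∈ Submonoid.closure (Set.range fun a => y a ^ m)) :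
    ∃ p' ∈ Submonoid.closure (Set.range fun a => y a ^ m), p * y b ^ j = y b ^ j * p' := by
  induction j with
  | zero => exact ⟨p, hp, by simp⟩
  | succ j ih =>
    obtain ⟨p₁, h₁, e₁⟩ := ih
    obtain ⟨p₂, h₂, e₂⟩ := exists_mul_generator hy hm hnd hsf hybe b h₁
    exact ⟨p₂, h₂, by rw [pow_succ, ← mul_assoc, e₁, mul_assoc, e₂, mul_assoc]⟩

variable {ι : Type*} (x : ι → X) (α : ι → ℕ)

/-- Divide each exponent by `m` with remainder and move the `m`-th powers to the left. The remaining
factors have exponents below `m`, leaving finitely many module generators. -/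
theorem exists_left_factor (l : List ι) :
    ∃ p ∈ Submonoid.closure (Set.range fun a => y a ^ m),
      (l.map fun i => y (x i) ^ α i).prod = p * (l.map fun i => y (x i) ^ (α i % m)).prod := by
  induction l with
  | nil => exact ⟨1, one_mem _, by simp⟩
  | cons i l ih =>
    obtain ⟨p₁, h₁, e₁⟩ := ih
    obtain ⟨p₂, h₂, e₂⟩ := exists_pow_generator_mul hy hm hnd hsf hybe (x i) (α i % m) h₁
    refine ⟨(y (x i) ^ m) ^ (α i / m) * p₂,
      mul_mem (pow_mem (Submonoid.subset_closure (Set.mem_range_self (x i))) _) h₂, ?_⟩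
    rw [List.map_cons, List.prod_cons, List.map_cons, List.prod_cons, e₁]
    conv_lhs => rw [← Nat.div_add_mod (α i) m, pow_add, pow_mul]
    rw [mul_assoc, ← mul_assoc (y (x i) ^ (α i % m)), e₂]
    simp only [mul_assoc]

theorem exists_right_factor (l : List ι) :
    ∃ p ∈ Submonoid.closure (Set.range fun a => y a ^ m),
      (l.map fun i => y (x i) ^ α i).prod = (l.map fun i => y (x i) ^ (α i % m)).prod * p := by
  have hmove : ∀ (l : List ι) (β : ι → ℕ),
      ∀ p ∈ Submonoid.closure (Set.range fun a => y a ^ m),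
      ∃ p' ∈ Submonoid.closure (Set.range fun a => y a ^ m),
        p * (l.map fun i => y (x i) ^ β i).prod = (l.map fun i => y (x i) ^ β i).prod * p' := by
    intro l β
    induction l with
    | nil => exact fun p hp => ⟨p, hp, by simp⟩
    | cons i l ih =>
      intro p hp
      obtain ⟨p₁, h₁, e₁⟩ := exists_mul_pow_generator hy hm hnd hsf hybe (x i) (β i) hp
      obtain ⟨p₂, h₂, e₂⟩ := ih p₁ h₁
      exact ⟨p₂, h₂, by
        rw [List.map_cons, List.prod_cons, ← mul_assoc, e₁, mul_assoc, e₂, mul_assoc]⟩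
  obtain ⟨p, hp, e⟩ := exists_left_factor hy hm hnd hsf hybe x α l
  obtain ⟨p', hp', e'⟩ := hmove l (fun i => α i % m) p hp
  exact ⟨p', hp', e.trans e'⟩

end Powers

/-! ### The quadratic algebra is Noetherian -/

section QuadraticAlgebra

variable {k : Type*} [Field k] {X : Type*} {r : X × X ≃ X × X} {n : ℕ} {x : Fin n ≃ X}

variable (k r) in
/-- The image of a word in the quadratic algebra. -/
noncomputable def toQuadraticAlgebra : FreeMonoid X →* quadraticAlgebra k r :=
  ((relationIdeal k r).ringCon.mkₐ (α := k) : FreeAlgebra k X →* quadraticAlgebra k r).comp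
    (wordHom k)

theorem toQuadraticAlgebra_eq {u v : FreeMonoid X} (h : wordCon r u v) :
    toQuadraticAlgebra k r u = toQuadraticAlgebra k r v :=
  (RingCon.eq _).2 ((TwoSidedIdeal.rel_iff _ _ _).2 (wordHom_sub_mem h))

theorem span_toQuadraticAlgebra (hN : HasOrderedNormalForms r x) :
    Submodule.span k (toQuadraticAlgebra k r '' orderedMonomials x) = ⊤ := by
  refine eq_top_iff.2 fun b _ => ?_
  obtain ⟨f, rfl⟩ := RingCon.mkₐ_surjective (α := k) (relationIdeal k r).ringCon b
  rw [eq_sum_coeff k f, map_finsuppSum]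
  refine Submodule.sum_mem _ fun u _ => ?_
  simp only [map_smul]
  refine Submodule.smul_mem _ _ (Submodule.subset_span ?_)
  obtain ⟨v, hv, huv⟩ := hN.exists_orderedMonomial u
  exact ⟨v, hv, (toQuadraticAlgebra_eq huv).symm⟩

theorem isNoetherianRing_quadraticAlgebra (hN : HasOrderedNormalForms r x)
    (hnd : IsNondegenerate r) (hinv : IsInvolutive r) :
    IsNoetherianRing (quadraticAlgebra k r) ∧ IsNoetherianRing (quadraticAlgebra k r)ᵐᵒᵖ := by
  have : Finite X := Finite.of_equiv _ x
  have hsf := isSquareFree hN hnd hinv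
  have hybe := satisfiesYBE hN hnd hinv
  obtain ⟨m, hm⟩ : ∃ m, m = Nat.card (Equiv.Perm X) := ⟨_, rfl⟩
  have hm0 : 0 < m := hm ▸ Nat.card_pos
  let y : X → quadraticAlgebra k r := fun a => toQuadraticAlgebra k r (FreeMonoid.of a)
  have hy : ∀ a b, y a * y b = y (leftAct r a b) * y (rightAct r b a) := by
    intro a b
    simp only [y, ← map_mul]
    exact toQuadraticAlgebra_eq (wordCon_pair (a, b))
  have hcomm : ∀ a ∈ Set.range (fun a => y a ^ m), ∀ b ∈ Set.range (fun a => y a ^ m),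
      a * b = b * a := by
    rintro _ ⟨a, rfl⟩ _ ⟨b, rfl⟩
    exact pow_card_perm_commute hy hm hnd hsf hybe b a
  have hT : (Set.range fun β : Fin n → Fin m =>
      ((List.finRange n).map fun i => y (x i) ^ (β i : ℕ)).prod).Finite := Set.finite_range _
  have hword : ∀ α : Fin n → ℕ,
      toQuadraticAlgebra k r (List.ofFn fun i => FreeMonoid.of (x i) ^ α i).prod =
        ((List.finRange n).map fun i => y (x i) ^ α i).prod := by
    intro α
    rw [map_list_prod, List.ofFn_eq_map, List.map_map]
    simp only [Function.comp_def, map_pow, y]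
  constructor
  · refine isNoetherianRing_of_commuting (Set.finite_range _) hcomm hT
      (span_toQuadraticAlgebra hN) ?_
    rintro _ ⟨_, ⟨α, rfl⟩, rfl⟩
    obtain ⟨p, hp, e⟩ := exists_left_factor hy hm hnd hsf hybe x α (List.finRange n)
    exact ⟨p, hp, _, ⟨fun i => ⟨α i % m, Nat.mod_lt _ hm0⟩, rfl⟩, (hword α).trans e⟩
  · refine isNoetherianRing_op_of_commuting (Set.finite_range _) hcomm hT
      (span_toQuadraticAlgebra hN) ?_
    rintro _ ⟨_, ⟨α, rfl⟩, rfl⟩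
    obtain ⟨p, hp, e⟩ := exists_right_factor hy hm hnd hsf hybe x α (List.finRange n)
    exact ⟨p, hp, _, ⟨fun i => ⟨α i % m, Nat.mod_lt _ hm0⟩, rfl⟩, (hword α).trans e⟩

end QuadraticAlgebra

end QuadraticSet

/-! ### The main theorem

A fixed point `(x_i, x_j)` of `r` has `i ≤ j`, since `x_j x_i` with `i < j` is not normal. As every
letter is the first (and the second) entry of exactly one fixed point of the non-degenerate map
`r`, all fixed points are diagonal. So the hypotheses already force square-freeness, and each of the
five equivalent conditions is established from them. -/

theorem mainTheorem4 {k : Type*} [Field k] {X : Type*} {n : ℕ}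
    (r : X × X ≃ X × X)
    (hnd : QuadraticSet.IsNondegenerate r) (hinv : QuadraticSet.IsInvolutive r)
    (x : Fin n ≃ X)
    (hN : FreeGroebner.normalWords x {f | f ∈ QuadraticSet.relationIdeal k r} =
      FreeGroebner.orderedMonomials x) :
    (FreeGroebner.IsPBW x (QuadraticSet.relationIdeal k r) ∧
      (∀ f ∈ QuadraticSet.monicRelations k r x, FreeGroebner.IsQuadratic f) ∧
      FreeGroebner.IsGroebnerBasis x (QuadraticSet.monicRelations k r x)
        (QuadraticSet.relationIdeal k r)) ∧
    List.TFAE [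
      IsNoetherianRing (QuadraticSet.quadraticAlgebra k r) ∧
        IsNoetherianRing (QuadraticSet.quadraticAlgebra k r)ᵐᵒᵖ,
      QuadraticSet.IsSquareFree r,
      QuadraticSet.SatisfiesYBE r,
      FreeGroebner.IsBinomialSkewPolynomialRing x (QuadraticSet.relationIdeal k r),
      ∃ y : Fin n ≃ X,
        FreeGroebner.IsBinomialSkewPolynomialRing y (QuadraticSet.relationIdeal k r)] := by
  have hN' := QuadraticSet.hasOrderedNormalForms_of_normalWords_eq hN
  have hG := QuadraticSet.isGroebnerBasis_monicRelations hN hinv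
  have hB := QuadraticSet.isBinomialSkewPolynomialRing hN hnd hinv
  refine ⟨⟨⟨_, QuadraticSet.monicRelations_finite,
    fun f => QuadraticSet.isQuadratic_of_mem_monicRelations, hG⟩,
    fun f => QuadraticSet.isQuadratic_of_mem_monicRelations, hG⟩, ?_⟩
  refine List.tfae_of_forall True _ fun P hP => iff_true_intro ?_
  simp only [List.mem_cons, List.not_mem_nil, or_false] at hP
  rcases hP with rfl | rfl | rfl | rfl | rfl
  · exact QuadraticSet.isNoetherianRing_quadraticAlgebra hN' hnd hinv
  · exact QuadraticSet.isSquareFree hN' hnd hinv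
  · exact QuadraticSet.satisfiesYBE hN' hnd hinv
  · exact hB
  · exact ⟨x, hB⟩
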